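/- Let $k$ be a field. A correspondence from a finite set $X$ to a finite set $Y$ is a subset of $Y\times X$; finite sets and correspondences form a category $\mathcal C$, with composition $RS=\{(z,x)\mid \exists y,\ (z,y)\in R,\ (y,x)\in S\}$ for $R\subseteq Z\times Y$, $S\subseteq Y\times X$. We write $\mathcal C(Y,X)$ for the set of correspondences from $X$ to $Y$ and $k\mathcal C$ for the $k$-linearization of $\mathcal C$. A correspondence functor is a $k$-linear functor $k\mathcal C\to k\text{-Mod}$; it is simple if it is nonzero and has no proper nonzero subfunctor. Let $E$ be a finite set. For a permutation $\sigma$ of $E$ put $\Delta_\sigma=\{(\sigma(x),x)\mid x\in E\}$. Let $\mathcal P_E$ (the algebra of permuted orders) be the quotient of the monoid algebra $k\mathcal C(E,E)$ by the two-sided ideal generated by all relations which factor through a set of cardinality smaller than $|E|$ and all differences $S-\overline S$, where $S$ is a reflexive relation on $E$ and $\overline S$ its transitive closure. For a partial order $R\subseteq E\times E$ let $f_R=\sum_{S\supseteq R}\mu(R,S)\,S\in\mathcal P_E$, where $S$ runs over the partial orders on $E$ containing $R$ and $\mu$ is the Möbius function of the poset of all partial orders on $E$, ordered by inclusion. Let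 $\operatorname{Aut}(E,R)$ be the group of permutations of $E$ preserving $R$; it acts on the right on $\mathcal P_Ef_R$ through multiplication by the elements $\Delta_\sigma$. For a $k\operatorname{Aut}(E,R)$-module $V$ put $T_{R,V}=\mathcal P_Ef_R\otimes_{k\operatorname{Aut}(E,R)}V$, a $k\mathcal C(E,E)$-module. For a $k\mathcal C(E,E)$-module $W$ let $L_{E,W}=k\mathcal C(-,E)\otimes_{k\mathcal C(E,E)}W$, let $J_{E,W}$ be its subfunctor $$J_{E,W}(X)=\Big\{\sum_i\varphi_i\otimes w_i\in L_{E,W}(X)\ \Big|\ \sum_i(\psi\varphi_i)\cdot w_i=0\ \text{ for all }\psi\in k\mathcal C(E,X)\Big\},$$ and let $S_{E,W}=L_{E,W}/J_{E,W}$ and $S_{E,R,V}=S_{E,T_{R,V}}$. Consider triples $(E,R,V)$, where $E$ is a finite set, $R$ is a partial order on $E$ and $V$ is a simple $k\operatorname{Aut}(E,R)$-module. Two triples $(E,R,V)$ and $(E',R',V')$ are isomorphic if there are an isomorphism of posets $e:(E,R)\to(E',R')$ and a $k$-linear isomorphism $f:V\to V'$ such that $f(a\cdot v)=(eae^{-1})\cdot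 f(v)$ for all $a\in\operatorname{Aut}(E,R)$ and $v\in V$. **Theorem.** For every triple $(E,R,V)$ the correspondence functor $S_{E,R,V}$ is simple, and $(E,R,V)\mapsto S_{E,R,V}$ induces a bijection from the set of isomorphism classes of triples $(E,R,V)$ to the set of isomorphism classes of simple correspondence functors over $k$. -/

import Mathlib

open CategoryTheory
open scoped TensorProduct

universe u

noncomputable section

/-! ## Balanced tensor products -/

section Balanced

variable {k : Type u} [CommRing k] {M : Type u} [Monoid M]
variable {A A' B C : Type u} [AddCommGroup A] [Module k A] [AddCommGroup A'] [Module k A']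
  [AddCommGroup B] [Module k B] [AddCommGroup C] [Module k C]

/-- The submodule of `A ⊗[k] B` generated by the elements `a m ⊗ b - a ⊗ m b`, where `A` is a
right `kM`-module (given by `r`) and `B` is a left `kM`-module (given by `l`). -/
def balancedSubmodule (r : Representation k Mᵐᵒᵖ A) (l : Representation k M B) :
    Submodule k (A ⊗[k] B) :=
  Submodule.span k {z | ∃ (a : A) (m : M) (b : B),
    z = (r (MulOpposite.op m) a) ⊗ₜ[k] b - a ⊗ₜ[k] (l m b)}

/-- The tensor product `A ⊗_{kM} B` of a right `kM`-module `A` and a left `kM`-module `B`,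
for a monoid `M`. -/
abbrev BalancedTensor (r : Representation k Mᵐᵒᵖ A) (l : Representation k M B) : Type u :=
  (A ⊗[k] B) ⧸ balancedSubmodule r l

/-- The element `a ⊗ b` of `A ⊗_{kM} B`. -/
def BalancedTensor.tmul (r : Representation k Mᵐᵒᵖ A) (l : Representation k M B) (a : A) (b : B) :
    BalancedTensor r l :=
  (balancedSubmodule r l).mkQ (a ⊗ₜ[k] b)

/-- The map `A ⊗_{kM} B → A' ⊗_{kM} B` induced by a homomorphism of right modules `A → A'`. -/
def BalancedTensor.map {r : Representation k Mᵐᵒᵖ A} {r' : Representation k Mᵐᵒᵖ A'}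
    (l : Representation k M B) (f : A →ₗ[k] A')
    (hf : ∀ (m : M) (a : A), f (r (MulOpposite.op m) a) = r' (MulOpposite.op m) (f a)) :
    BalancedTensor r l →ₗ[k] BalancedTensor r' l :=
  Submodule.mapQ _ _ (f.rTensor B) (by
    rw [balancedSubmodule, Submodule.span_le]
    rintro _ ⟨a, m, b, rfl⟩
    refine Submodule.subset_span ⟨f a, m, b, ?_⟩
    simp [hf])

@[simp]
lemma BalancedTensor.map_tmul {r : Representation k Mᵐᵒᵖ A} {r' : Representation k Mᵐᵒᵖ A'}
    (l : Representation k M B) (f : A →ₗ[k] A')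
    (hf : ∀ (m : M) (a : A), f (r (MulOpposite.op m) a) = r' (MulOpposite.op m) (f a))
    (a : A) (b : B) :
    BalancedTensor.map l f hf (BalancedTensor.tmul r l a b) = BalancedTensor.tmul r' l (f a) b :=
  rfl

/-- The linear map `A ⊗_{kM} B → C` induced by a balanced bilinear map. -/
def BalancedTensor.lift {r : Representation k Mᵐᵒᵖ A} {l : Representation k M B}
    (g : A →ₗ[k] B →ₗ[k] C)
    (hg : ∀ (a : A) (m : M) (b : B), g (r (MulOpposite.op m) a) b = g a (l m b)) :
    BalancedTensor r l →ₗ[k] C :=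
  Submodule.liftQ _ (TensorProduct.lift g) (by
    rw [balancedSubmodule, Submodule.span_le]
    rintro _ ⟨a, m, b, rfl⟩
    simp [hg])

@[simp]
lemma BalancedTensor.lift_tmul {r : Representation k Mᵐᵒᵖ A} {l : Representation k M B}
    (g : A →ₗ[k] B →ₗ[k] C)
    (hg : ∀ (a : A) (m : M) (b : B), g (r (MulOpposite.op m) a) b = g a (l m b))
    (a : A) (b : B) :
    BalancedTensor.lift g hg (BalancedTensor.tmul r l a b) = g a b :=
  rfl

lemma BalancedTensor.hom_ext {r : Representation k Mᵐᵒᵖ A} {l : Representation k M B}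
    {f g : BalancedTensor r l →ₗ[k] C}
    (h : ∀ a b, f (BalancedTensor.tmul r l a b) = g (BalancedTensor.tmul r l a b)) : f = g :=
  Submodule.linearMap_qext _ (TensorProduct.ext' h)

end Balanced

/-! ## The category of finite sets and correspondences -/

/-- A finite set, seen as an object of the category of finite sets and correspondences. -/
structure FinCorr : Type (u + 1) where
  carrier : Type u
  [finite : Finite carrier]

namespace FinCorr

instance : CoeSort FinCorr.{u} (Type u) := ⟨carrier⟩

instance (X : FinCorr.{u}) : Finite X := X.finite

/-- Morphisms from `X` to `Y` are the subsets of `Y × X`; the composite of `S ⊆ Y × X` followed by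
`R ⊆ Z × Y` is `RS = {(z, x) | ∃ y, (z, y) ∈ R ∧ (y, x) ∈ S}`. -/
instance : Category.{u} FinCorr.{u} where
  Hom X Y := Set (Y × X)
  id X := {p : X × X | p.1 = p.2}
  comp {X Y Z} S R := {p : Z × X | ∃ y : Y, (p.1, y) ∈ R ∧ (y, p.2) ∈ S}
  id_comp := by
    intro X Y S
    ext ⟨y, x⟩
    simp
  comp_id := by
    intro X Y S
    ext ⟨y, x⟩
    simp
  assoc := by
    intro W X Y Z (Q : Set (X × W)) (S : Set (Y × X)) (R : Set (Z × Y))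
    refine Set.ext fun ⟨z, w⟩ => ?_
    change (∃ y, (z, y) ∈ R ∧ ∃ x, (y, x) ∈ S ∧ (x, w) ∈ Q) ↔
      ∃ x, (∃ y, (z, y) ∈ R ∧ (y, x) ∈ S) ∧ (x, w) ∈ Q
    constructor
    · rintro ⟨y, h1, x, h2, h3⟩
      exact ⟨x, ⟨y, h1, h2⟩, h3⟩
    · rintro ⟨x, ⟨y, h1, h2⟩, h3⟩
      exact ⟨y, h1, x, h2, h3⟩

/-- The relation on `E` given by a subset of `E × E`, as an element of the monoid of relations on
`E`, whose product is the composition `RS`. -/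
def rel {E : FinCorr.{u}} (S : Set (E × E)) : End E := S

/-- The relation `Δ_σ = {(σ x, x)}` associated with a permutation `σ`. -/
def perm {E : FinCorr.{u}} : Equiv.Perm E →* End E where
  toFun σ := rel {p : E × E | p.1 = σ p.2}
  map_one' := rfl
  map_mul' σ τ := by
    refine Set.ext (α := E × E) fun ⟨x, z⟩ => ?_
    change x = (σ * τ) z ↔ ∃ y, x = σ y ∧ y = τ z
    simp

/-- A relation on `E` is inessential if it factors through a set of smaller cardinality. -/
def IsInessential {E : FinCorr.{u}} (Q : End E) : Prop :=
  ∃ (Y : FinCorr.{u}) (A : E ⟶ Y) (B : Y ⟶ E), Nat.card Y < Nat.card E ∧ Q = A ≫ B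

end FinCorr

open FinCorr

/-! ## Correspondence functors -/

/-- `k`-linear functors from the `k`-linearization of the category of correspondences to the
category of `k`-modules. -/
def isLinearFunctor (k : Type u) [CommRing k] :
    ObjectProperty (Free k FinCorr.{u} ⥤ ModuleCat.{u} k) :=
  fun F => F.Additive ∧ F.Linear k

/-- The category of correspondence functors over `k`. -/
abbrev CorrFunctor (k : Type u) [CommRing k] := (isLinearFunctor k).FullSubcategory

/-- A subfunctor of a correspondence functor. -/
structure CorrFunctor.Subfunctor {k : Type u} [CommRing k] (F : CorrFunctor k) where
  carrier : ∀ X : Free k FinCorr.{u}, Submodule k (F.obj.obj X)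
  map_mem : ∀ {X Y : Free k FinCorr.{u}} (α : X ⟶ Y) (m : F.obj.obj X),
    m ∈ carrier X → (F.obj.map α).hom m ∈ carrier Y

/-- A correspondence functor is simple if it is nonzero and has no proper nonzero subfunctor. -/
def CorrFunctor.IsSimple {k : Type u} [CommRing k] (F : CorrFunctor k) : Prop :=
  (∃ X, Nontrivial (F.obj.obj X)) ∧
    ∀ N : F.Subfunctor, (∀ X, N.carrier X = ⊥) ∨ (∀ X, N.carrier X = ⊤)

/-- Simple correspondence functors. -/
abbrev SimpleCorrFunctor (k : Type u) [CommRing k] := {F : CorrFunctor k // F.IsSimple}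

/-- Isomorphism of simple correspondence functors. -/
instance simpleCorrFunctorSetoid (k : Type u) [CommRing k] : Setoid (SimpleCorrFunctor k) :=
  (isIsomorphicSetoid (CorrFunctor k)).comap Subtype.val

/-! ## The functors `L_{E,W}` and `S_{E,W}` -/

section Functors

variable {k : Type u} [CommRing k] (E : FinCorr.{u}) {W : Type u} [AddCommGroup W] [Module k W]
  (ρ : Representation k (End E) W)

/-- The right action of the monoid of relations on `E` on the free module with basis the set of
correspondences from `E` to `X`, by composition. -/
def corrRight (k : Type u) [CommRing k] (E X : FinCorr.{u}) :
    Representation k (End E)ᵐᵒᵖ ((E ⟶ X) →₀ k) where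
  toFun m := Finsupp.lmapDomain k k (fun φ : E ⟶ X => (MulOpposite.unop m : E ⟶ E) ≫ φ)
  map_one' := by
    refine Finsupp.lhom_ext fun φ c => ?_
    simp only [Finsupp.lmapDomain_apply, Finsupp.mapDomain_single, Module.End.one_apply]
    exact congrArg (fun ψ => Finsupp.single ψ c) (Category.id_comp φ)
  map_mul' m n := by
    refine Finsupp.lhom_ext fun φ c => ?_
    simp only [Finsupp.lmapDomain_apply, Finsupp.mapDomain_single, Module.End.mul_apply]
    exact congrArg (fun ψ => Finsupp.single ψ c)
      (Category.assoc (MulOpposite.unop m : E ⟶ E) (MulOpposite.unop n) φ)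

/-- The evaluation at `X` of `L_{E,W} = k𝒞(-,E) ⊗_{k𝒞(E,E)} W`. -/
abbrev LObj (X : FinCorr.{u}) : Type u := BalancedTensor (corrRight k E X) ρ

/-- The action of a correspondence on `L_{E,W}`, `α · (φ ⊗ w) = (α φ) ⊗ w`. -/
def LMap {X Y : FinCorr.{u}} (α : X ⟶ Y) : LObj E ρ X →ₗ[k] LObj E ρ Y :=
  BalancedTensor.map ρ (Finsupp.lmapDomain k k (fun φ : E ⟶ X => φ ≫ α)) (by
    intro m a
    simp only [corrRight, MonoidHom.coe_mk, OneHom.coe_mk, Finsupp.lmapDomain_apply,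
      ← Finsupp.mapDomain_comp]
    congr 1
    funext φ
    simp)

/-- For a correspondence `ψ` from `X` to `E`, the map `L_{E,W}(X) → W`, `φ ⊗ w ↦ (ψ φ) · w`. -/
def LEval {X : FinCorr.{u}} (ψ : X ⟶ E) : LObj E ρ X →ₗ[k] W :=
  BalancedTensor.lift
    (Finsupp.lift (W →ₗ[k] W) k (E ⟶ X) (fun φ => ρ (φ ≫ ψ : E ⟶ E))) (by
    intro a m b
    induction a using Finsupp.induction_linear with
    | zero => simp
    | add f g hf hg => simp only [map_add, LinearMap.add_apply, hf, hg]
    | single φ c =>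
      have h : ρ ((m ≫ φ) ≫ ψ : E ⟶ E) b = ρ (φ ≫ ψ : E ⟶ E) (ρ m b) := by
        rw [← Module.End.mul_apply, ← map_mul, End.mul_def, Category.assoc]
      simp only [corrRight, MonoidHom.coe_mk, OneHom.coe_mk, Finsupp.lmapDomain_apply,
        Finsupp.mapDomain_single, MulOpposite.unop_op]
      simp only [Finsupp.lift_apply, zero_smul, Finsupp.sum_single_index, LinearMap.smul_apply, h])

/-- The submodule `J_{E,W}(X)` of `L_{E,W}(X)`, consisting of the elements `∑ φ_i ⊗ w_i` such that
`∑ (ψ φ_i) · w_i = 0` for all `ψ`. -/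
def JObj (X : FinCorr.{u}) : Submodule k (LObj E ρ X) :=
  ⨅ ψ : X ⟶ E, LinearMap.ker (LEval E ρ ψ)

lemma LEval_LMap {X Y : FinCorr.{u}} (α : X ⟶ Y) (ψ : Y ⟶ E) (z : LObj E ρ X) :
    LEval E ρ ψ (LMap E ρ α z) = LEval E ρ (α ≫ ψ) z := by
  suffices h : (LEval E ρ ψ).comp (LMap E ρ α) = LEval E ρ (α ≫ ψ) from LinearMap.congr_fun h z
  refine BalancedTensor.hom_ext fun a b => ?_
  simp only [LinearMap.comp_apply, LEval, LMap, BalancedTensor.map_tmul, BalancedTensor.lift_tmul]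
  induction a using Finsupp.induction_linear with
  | zero => simp
  | add f g hf hg => simp only [map_add, LinearMap.add_apply, hf, hg]
  | single φ c => simp

lemma JObj_le_comap {X Y : FinCorr.{u}} (α : X ⟶ Y) :
    JObj E ρ X ≤ (JObj E ρ Y).comap (LMap E ρ α) := by
  intro z hz
  simp only [JObj, Submodule.mem_comap, Submodule.mem_iInf, LinearMap.mem_ker] at hz ⊢
  intro ψ
  rw [LEval_LMap]
  exact hz _

lemma LMap_id (X : FinCorr.{u}) : LMap E ρ (𝟙 X) = LinearMap.id := by
  refine BalancedTensor.hom_ext fun a b => ?_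
  simp [LMap, ← Function.id_def]

lemma LMap_comp {X Y Z : FinCorr.{u}} (α : X ⟶ Y) (β : Y ⟶ Z) :
    LMap E ρ (α ≫ β) = (LMap E ρ β).comp (LMap E ρ α) := by
  refine BalancedTensor.hom_ext fun a b => ?_
  simp only [LinearMap.comp_apply, LMap, BalancedTensor.map_tmul, Finsupp.lmapDomain_apply,
    ← Finsupp.mapDomain_comp]
  congr 2
  funext φ
  simp

/-- The functor `S_{E,W} = L_{E,W} / J_{E,W}`, before linear extension to the linearization. -/
def SFunctorAux : FinCorr.{u} ⥤ ModuleCat.{u} k where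
  obj X := ModuleCat.of k (LObj E ρ X ⧸ JObj E ρ X)
  map {X Y} α := ModuleCat.ofHom (Submodule.mapQ _ _ (LMap E ρ α) (JObj_le_comap E ρ α))
  map_id X := by
    ext1
    refine Submodule.linearMap_qext _ (LinearMap.ext fun z => ?_)
    simp [LMap_id]
  map_comp α β := by
    ext1
    refine Submodule.linearMap_qext _ (LinearMap.ext fun z => ?_)
    simp [LMap_comp]

/-- The correspondence functor `S_{E,W} = L_{E,W} / J_{E,W}`. -/
def SFunctor : CorrFunctor k :=
  ⟨Free.lift k (SFunctorAux E ρ), inferInstance, inferInstance⟩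

end Functors

/-! ## Orders, the algebra of permuted orders and the fundamental modules -/

/-- A (partial) order on `E`: a reflexive, antisymmetric and transitive subset of `E × E`. -/
structure IsOrderRel {E : Type u} (R : Set (E × E)) : Prop where
  refl : ∀ x, (x, x) ∈ R
  antisymm : ∀ x y, (x, y) ∈ R → (y, x) ∈ R → x = y
  trans : ∀ x y z, (x, y) ∈ R → (y, z) ∈ R → (x, z) ∈ R

/-- The set of orders on `E`. -/
@[ext]
structure OrderRel (E : Type u) where
  toSet : Set (E × E)
  isOrder : IsOrderRel toSet

/-- Orders on `E` are ordered by inclusion. -/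
instance (E : Type u) : PartialOrder (OrderRel E) :=
  PartialOrder.lift OrderRel.toSet fun _ _ => OrderRel.ext

instance (E : Type u) [Finite E] : Finite (OrderRel E) :=
  Finite.of_injective OrderRel.toSet fun _ _ => OrderRel.ext

instance (E : Type u) [Finite E] : Fintype (OrderRel E) := Fintype.ofFinite _

open scoped Classical in
instance (E : Type u) [Finite E] : LocallyFiniteOrder (OrderRel E) :=
  Fintype.toLocallyFiniteOrder

/-- The group `Aut(E,R)` of permutations of `E` preserving `R`. -/
def OrderRel.aut {E : Type u} (R : OrderRel E) : Subgroup (Equiv.Perm E) where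
  carrier := {σ | ∀ x y, (σ x, σ y) ∈ R.1 ↔ (x, y) ∈ R.1}
  mul_mem' {σ τ} hσ hτ x y := by simp only [Equiv.Perm.mul_apply]; rw [hσ, hτ]
  one_mem' x y := by simp
  inv_mem' {σ} hσ x y := by rw [← hσ]; simp

/-- The conjugation action of a permutation `σ` on the set of orders, `R ↦ {(σ x, σ y)}`. -/
def OrderRel.conj {E : Type u} (σ : Equiv.Perm E) : OrderRel E ≃o OrderRel E where
  toFun R := ⟨{p | (σ.symm p.1, σ.symm p.2) ∈ R.1},
    ⟨fun _ => R.2.refl _, fun _ _ h h' => σ.symm.injective (R.2.antisymm _ _ h h'),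
      fun _ _ _ h h' => R.2.trans _ _ _ h h'⟩⟩
  invFun R := ⟨{p | (σ p.1, σ p.2) ∈ R.1},
    ⟨fun _ => R.2.refl _, fun _ _ h h' => σ.injective (R.2.antisymm _ _ h h'),
      fun _ _ _ h h' => R.2.trans _ _ _ h h'⟩⟩
  left_inv R := by ext ⟨x, y⟩; simp
  right_inv R := by ext ⟨x, y⟩; simp
  map_rel_iff' {R S} := by
    constructor
    · rintro h ⟨x, y⟩ hxy
      have := @h (σ x, σ y) (by simpa using hxy)
      simpa using this
    · rintro h ⟨x, y⟩ hxy
      exact h hxy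

lemma OrderRel.conj_eq_self {E : Type u} (R : OrderRel E) {σ : Equiv.Perm E} (hσ : σ ∈ R.aut) :
    OrderRel.conj σ R = R := by
  ext ⟨x, y⟩
  have := hσ (σ.symm x) (σ.symm y)
  simp only [Equiv.apply_symm_apply] at this
  exact this.symm

/-- The transitive closure of a relation. -/
def transClosure {E : Type u} (S : Set (E × E)) : Set (E × E) :=
  {p | Relation.TransGen (fun a b => (a, b) ∈ S) p.1 p.2}

section PermutedOrders

variable (k : Type u) [CommRing k] (E : FinCorr.{u})

/-- The relations imposed on the algebra of the monoid of relations on `E` in order to obtain the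
algebra of permuted orders: inessential relations are zero (this gives the essential algebra), and
a reflexive relation is equal to its transitive closure (in the essential algebra, the differences
`S - transClosure S` generate the nilpotent ideal that has to be factored out). -/
inductive PermutedOrdersRel : MonoidAlgebra k (End E) → MonoidAlgebra k (End E) → Prop
  | inessential (Q : End E) (hQ : IsInessential Q) :
      PermutedOrdersRel (MonoidAlgebra.of k (End E) Q) 0
  | reflexive (S : Set (E × E)) (hS : ∀ x, (x, x) ∈ S) :
      PermutedOrdersRel (MonoidAlgebra.of k (End E) (rel S))
        (MonoidAlgebra.of k (End E) (rel (transClosure S)))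

/-- The algebra of permuted orders `𝒫_E`, a quotient of the essential algebra. It has a basis
consisting of the `Δ_σ R` for `σ` a permutation of `E` and `R` an order on `E`; the product of two
orders is the transitive closure of their union if this is an order, and zero otherwise. -/
abbrev PermutedOrders : Type u := RingQuot (PermutedOrdersRel k E)

/-- The image in `𝒫_E` of a relation on `E`. -/
def relClass : End E →* PermutedOrders k E :=
  (RingQuot.mkAlgHom k (PermutedOrdersRel k E) : MonoidAlgebra k (End E) →* PermutedOrders k E).comp
    (MonoidAlgebra.of k (End E))

open scoped Classical in
/-- The idempotent `f_R = ∑_{S ⊇ R} μ(R,S) S` of `𝒫_E`, where `μ` is the Möbius function of the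
poset of all orders on `E`, ordered by inclusion. -/
def fIdem (R : OrderRel E) : PermutedOrders k E :=
  ∑ S : OrderRel E with R ≤ S, IncidenceAlgebra.mu k R S • relClass k E (rel S.1)

open scoped Classical in
lemma mu_orderIso {α : Type u} [PartialOrder α] [LocallyFiniteOrder α] (e : α ≃o α) (a b : α) :
    IncidenceAlgebra.mu k (e a) (e b) = IncidenceAlgebra.mu k a b := by
  by_cases hab : a = b
  · subst hab; simp
  · have hwf : ∀ n : ℕ, ∀ b : α, (Finset.Icc a b).card = n →
        IncidenceAlgebra.mu k (e a) (e b) = IncidenceAlgebra.mu k a b := by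
      intro n
      induction n using Nat.strong_induction_on with
      | _ n ih =>
        intro b hb
        rw [IncidenceAlgebra.mu_apply, IncidenceAlgebra.mu_apply a b]
        by_cases h : a = b
        · simp [h]
        · rw [if_neg (fun h' => h (e.injective h')), if_neg h]
          congr 1
          symm
          refine Finset.sum_bij (fun x _ => e x) ?_ ?_ ?_ ?_
          · intro x hx; simpa using hx
          · intro x _ y _ hxy; exact e.injective hxy
          · intro y hy
            refine ⟨e.symm y, ?_, by simp⟩
            simpa [e.le_symm_apply, e.symm_apply_lt] using hy
          · intro x hx
            refine (ih _ ?_ x rfl).symm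
            rw [← hb]
            refine Finset.card_lt_card ?_
            rw [Finset.mem_Ico] at hx
            refine (Finset.ssubset_iff_of_subset
              (Finset.Icc_subset_Icc le_rfl hx.2.le)).mpr ⟨b, ?_, ?_⟩
            · simpa using hx.1.trans hx.2.le
            · simp only [Finset.mem_Icc, not_and]
              intro _ h'
              exact absurd hx.2 (not_lt_of_ge h')
    exact hwf _ b rfl

lemma relClass_conj (σ : Equiv.Perm E) (S : OrderRel E) :
    relClass k E (rel (OrderRel.conj σ S).1) * relClass k E (perm σ) =
      relClass k E (perm σ) * relClass k E (rel S.1) := by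
  rw [← map_mul, ← map_mul]
  refine congrArg _ (Set.ext (α := E × E) fun ⟨x, z⟩ => ?_)
  change (∃ y, (σ.symm x, σ.symm y) ∈ S.1 ∧ y = σ z) ↔ ∃ y, x = σ y ∧ (y, z) ∈ S.1
  constructor
  · rintro ⟨y, h, rfl⟩
    exact ⟨σ.symm x, by simp, by simpa using h⟩
  · rintro ⟨y, rfl, h⟩
    exact ⟨σ z, by simpa using h, rfl⟩

/-- `f_{σR} Δ_σ = Δ_σ f_R`. -/
lemma fIdem_conj (σ : Equiv.Perm E) (R : OrderRel E) :
    fIdem k E (OrderRel.conj σ R) * relClass k E (perm σ) =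
      relClass k E (perm σ) * fIdem k E R := by
  classical
  rw [fIdem, fIdem, Finset.sum_mul, Finset.mul_sum]
  symm
  refine Finset.sum_bij (fun S _ => OrderRel.conj σ S) ?_ ?_ ?_ ?_
  · intro S hS
    simpa using hS
  · intro S _ T _ h
    exact (OrderRel.conj σ).injective h
  · intro S hS
    refine ⟨(OrderRel.conj σ).symm S, ?_, by simp⟩
    simpa [(OrderRel.conj σ).le_symm_apply] using hS
  · intro S _
    rw [smul_mul_assoc, mul_smul_comm, relClass_conj]
    congr 1
    exact (mu_orderIso k (OrderRel.conj σ) R S).symm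

variable {E}

/-- The fundamental module `𝒫_E f_R`. -/
def fundamentalModule (R : OrderRel E) : Submodule k (PermutedOrders k E) :=
  LinearMap.range (LinearMap.mulRight k (fIdem k E R))

/-- The left action of relations on the fundamental module, by multiplication. -/
def fundamentalLeft (R : OrderRel E) : Representation k (End E) (fundamentalModule k R) where
  toFun Q := (LinearMap.mulLeft k (relClass k E Q)).restrict (by
    rintro _ ⟨x, rfl⟩
    exact ⟨relClass k E Q * x, by simp [mul_assoc]⟩)
  map_one' := by
    ext x
    change relClass k E 1 * x.1 = x.1
    rw [map_one, one_mul]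
  map_mul' Q Q' := by
    ext x
    change relClass k E (Q * Q') * x.1 = relClass k E Q * (relClass k E Q' * x.1)
    rw [map_mul, mul_assoc]

/-- The right action of `Aut(E,R)` on the fundamental module, by multiplication by `Δ_σ`. -/
def fundamentalRight (R : OrderRel E) :
    Representation k (R.aut)ᵐᵒᵖ (fundamentalModule k R) where
  toFun σ := (LinearMap.mulRight k (relClass k E (perm (σ.unop : Equiv.Perm E)))).restrict (by
    rintro _ ⟨x, rfl⟩
    refine ⟨x * relClass k E (perm (σ.unop : Equiv.Perm E)), ?_⟩
    have h := fIdem_conj k E (σ.unop : Equiv.Perm E) R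
    rw [R.conj_eq_self σ.unop.2] at h
    simp [mul_assoc, h])
  map_one' := by
    ext x
    change x.1 * relClass k E (perm 1) = x.1
    rw [map_one, map_one, mul_one]
  map_mul' σ τ := by
    ext x
    change x.1 * relClass k E (perm ((τ.unop : Equiv.Perm E) * (σ.unop : Equiv.Perm E))) =
      x.1 * relClass k E (perm (τ.unop : Equiv.Perm E)) *
        relClass k E (perm (σ.unop : Equiv.Perm E))
    rw [map_mul, map_mul, mul_assoc]

variable {k}

/-- The module `T_{R,V} = 𝒫_E f_R ⊗_{k Aut(E,R)} V` for the monoid of relations on `E`. -/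
def TRep (R : OrderRel E) {V : Type u} [AddCommGroup V] [Module k V]
    (ρ : Representation k R.aut V) :
    Representation k (End E) (BalancedTensor (A := fundamentalModule k R) (fundamentalRight k R) ρ) where
  toFun Q := BalancedTensor.map ρ (fundamentalLeft k R Q) (by
    intro σ x
    ext
    simp [fundamentalRight, fundamentalLeft, mul_assoc])
  map_one' := by
    refine BalancedTensor.hom_ext fun a b => ?_
    simp only [BalancedTensor.map_tmul, map_one, Module.End.one_apply]
  map_mul' Q Q' := by
    refine BalancedTensor.hom_ext fun a b => ?_
    simp only [BalancedTensor.map_tmul, map_mul, Module.End.mul_apply]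

end PermutedOrders

/-! ## Triples `(E,R,V)` -/

/-- A triple `(E,R,V)`, where `E` is a finite set, `R` is an order on `E` and `V` is a simple
`k Aut(E,R)`-module. -/
structure PosetTriple (k : Type u) [Field k] : Type (u + 1) where
  E : FinCorr.{u}
  R : OrderRel E
  V : Type u
  [addCommGroup : AddCommGroup V]
  [module : Module k V]
  ρ : Representation k R.aut V
  simple : ρ.IsIrreducible

namespace PosetTriple

attribute [instance] PosetTriple.addCommGroup PosetTriple.module

variable {k : Type u} [Field k]

/-- Two triples are isomorphic if there are an isomorphism of posets `e : (E,R) → (E',R')` and an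
isomorphism of `k`-modules `f : V → V'` which is compatible with the actions of `Aut(E,R)` and
`Aut(E',R')` via `a ↦ e a e⁻¹`. -/
def IsIso (t t' : PosetTriple k) : Prop :=
  ∃ (e : t.E ≃ t'.E) (_ : ∀ x y, (e x, e y) ∈ t'.R.1 ↔ (x, y) ∈ t.R.1) (f : t.V ≃ₗ[k] t'.V),
    ∀ (a : t.R.aut) (a' : t'.R.aut), (∀ x, a'.1 (e x) = e (a.1 x)) →
      ∀ v, f (t.ρ a v) = t'.ρ a' (f v)

/-- Isomorphism of triples is an equivalence relation. -/
instance setoid (k : Type u) [Field k] : Setoid (PosetTriple k) where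
  r := IsIso
  iseqv := by
    refine ⟨fun t => ?_, ?_, ?_⟩
    · refine ⟨Equiv.refl _, fun _ _ => Iff.rfl, LinearEquiv.refl _ _, fun a a' h v => ?_⟩
      have : a' = a := Subtype.ext (Equiv.ext h)
      simp [this]
    · rintro t t' ⟨e, he, f, hf⟩
      refine ⟨e.symm, fun x y => ?_, f.symm, fun a' a h v => ?_⟩
      · rw [← he]; simp
      · rw [LinearEquiv.symm_apply_eq, hf a a', LinearEquiv.apply_symm_apply]
        intro x
        have := h (e x)
        rw [Equiv.symm_apply_apply] at this
        rw [this, Equiv.apply_symm_apply]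
    · rintro t t' t'' ⟨e, he, f, hf⟩ ⟨e', he', f', hf'⟩
      refine ⟨e.trans e', fun x y => ?_, f.trans f', fun a a'' h v => ?_⟩
      · simp [he, he']
      · let b : t'.R.aut := ⟨(e.symm.trans a.1).trans e, fun x y => by
          simp only [Equiv.trans_apply]
          rw [he, a.2, ← he]
          simp⟩
        have hb : ∀ x, b.1 (e x) = e (a.1 x) := fun x => by simp [b]
        simp only [LinearEquiv.trans_apply]
        rw [hf a b hb, hf' b a'']
        intro x
        have := h (e.symm x)
        simp only [Equiv.trans_apply, Equiv.apply_symm_apply] at this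
        rw [this]
        simp [b]

/-- The correspondence functor `S_{E,R,V} = S_{E,T_{R,V}}`. -/
def toFunctor (t : PosetTriple k) : CorrFunctor k := SFunctor t.E (TRep t.R t.ρ)

end PosetTriple

end

/-! A simple functor `P` is recognised by its type (`HasType`): a set `E` of least cardinality with
`P(E)` nonzero, an order `R` on `E` whose idempotent `f_R` does not kill `P(E)`, and the
`Aut(E,R)`-module `f_R P(E)`. The theorem says that this type exists, is unique up to isomorphism,
determines `P`, and is realised by `S_{E,R,V}` for every triple.

The algebra rests on Hall's theorem (`isInessential_or_eq_perm_mul`): in `𝒫_E` every relation is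
zero or `Δ_σ T` with `T` an order. Möbius inversion makes the `f_R` orthogonal idempotents with sum
1, permuted by the `Δ_σ`, and `T f_R` is `f_R` or zero according to whether `T ≤ R`. Hence `f_S Q
f_R` is zero or `Δ_σ f_R` with `σR = S` (`fIdem_mul_relClass_mul_fIdem`). This one computation shows
that an irreducible `𝒫_E`-module involves a single conjugacy class of orders, that its component at
`R` is an irreducible `Aut(E,R)`-module, and that conversely `T_{R,V}` is irreducible with component
`V` at `R`. That `V` embeds in `T_{R,V}` needs `f_R` to be large enough in `𝒫_E`; the explicit
module `permRep` on the permutations of `E` detects this.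

Existence of a type: at a minimal `E` inessential relations act by zero on the irreducible module
`P(E)`, and a maximality argument (`closureEqLocus_ne_bot`) shows that reflexive relations act as
their closures, so `P(E)` is a `𝒫_E`-module. Uniqueness of the functor: if `P` and `P'` are simple
of the same type, the pairs in `P × P'` with the same images in `V` form a subfunctor, and
simplicity makes it the graph of an isomorphism (`HasType.nonempty_iso`). Uniqueness of the type is
`HasType.isIso`. Finally `S_{E,W}(E)` is `W`, `S_{E,W}` is simple when `W` is, and it vanishes below
`E` when inessential relations kill `W`. -/

noncomputable section

/-! ## Combinatorics of relations -/

namespace FinCorr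

/-- `y` is related to `x` by the correspondence `φ` from `X` to `Y`. -/
def Related {X Y : FinCorr.{u}} (φ : X ⟶ Y) (y : Y) (x : X) : Prop :=
  Set.Mem (show Set (Y × X) from φ) (y, x)

section Related

variable {X Y Z E : FinCorr.{u}}

lemma hom_ext {φ ψ : X ⟶ Y} (h : ∀ y x, Related φ y x ↔ Related ψ y x) : φ = ψ :=
  Set.ext (α := Y × X) fun ⟨y, x⟩ => h y x

/-- The correspondence given by a relation. -/
def ofRel (r : Y → X → Prop) : X ⟶ Y := show Set (Y × X) from {p | r p.1 p.2}

@[simp]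
lemma related_ofRel (r : Y → X → Prop) (y : Y) (x : X) : Related (ofRel r) y x ↔ r y x := Iff.rfl

@[simp]
lemma related_comp (φ : X ⟶ Y) (ψ : Y ⟶ Z) (z : Z) (x : X) :
    Related (φ ≫ ψ) z x ↔ ∃ y, Related ψ z y ∧ Related φ y x := Iff.rfl

@[simp]
lemma related_mul (Q Q' : End E) (x z : E) :
    Related (Q * Q' : End E) x z ↔ ∃ y, Related Q x y ∧ Related Q' y z := Iff.rfl

@[simp]
lemma related_rel (S : Set (E × E)) (x y : E) : Related (rel S) x y ↔ (x, y) ∈ S := Iff.rfl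

@[simp]
lemma related_perm (σ : Equiv.Perm E) (x y : E) :
    Related (perm σ : End E) x y ↔ x = σ y := Iff.rfl

lemma eq_rel (Q : End E) : Q = rel {p | Related Q p.1 p.2} := rfl

end Related

section Essential

variable {E : FinCorr.{u}}

/-- By Hall's theorem, a relation is inessential or is the product of a permutation and a
reflexive relation. -/
lemma isInessential_or_eq_perm_mul (Q : End E) :
    IsInessential Q ∨ ∃ (σ : Equiv.Perm E) (S : Set (E × E)),
      (∀ x, (x, x) ∈ S) ∧ Q = perm σ * rel S := by
  classical
  have : Fintype E := Fintype.ofFinite _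
  -- A perfect matching inside `Q` is the permutation sought; its absence gives a set violating
  -- Hall's condition.
  by_cases h : ∃ f : E → E, Function.Injective f ∧ ∀ x, Related Q (f x) x
  · right
    obtain ⟨f, hf, hQ⟩ := h
    let σ : Equiv.Perm E := Equiv.ofBijective f (Finite.injective_iff_bijective.mp hf)
    refine ⟨σ, {p | Related Q (σ p.1) p.2}, hQ, hom_ext fun x z => ?_⟩
    simp only [related_mul, related_perm, related_rel, Set.mem_ofPred_eq]
    exact ⟨fun h => ⟨σ.symm x, by simp, by simpa using h⟩, by rintro ⟨y, rfl, h⟩; exact h⟩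
  · left
    rw [← Fintype.all_card_le_filter_rel_iff_exists_injective (fun x y => Related Q y x)] at h
    push Not at h
    obtain ⟨A, hA⟩ := h
    let B : Finset E := {b | ∃ a ∈ A, Related Q b a}
    -- `A` has fewer neighbours than elements. Points of `A` are routed through their neighbours
    -- `B`, the other points through themselves, and `|B| + |E ∖ A| < |E|`.
    let Y : FinCorr.{u} := ⟨{b // b ∈ B} ⊕ {x // x ∉ A}⟩
    refine ⟨Y, ofRel fun y x => Sum.elim (fun b : {b // b ∈ B} => Related Q b x ∧ x ∈ A)
        (fun z : {x // x ∉ A} => z.1 = x) y,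
      ofRel fun x y => Sum.elim (fun b : {b // b ∈ B} => x = b.1)
        (fun z : {x // x ∉ A} => Related Q x z.1) y, ?_, hom_ext fun y x => ?_⟩
    · have h1 : Nat.card Y = B.card + Nat.card {x // x ∉ A} := by
        change Nat.card ({b // b ∈ B} ⊕ {x // x ∉ A}) = _
        rw [Nat.card_sum]; simp
      have h2 : Nat.card {x // x ∉ A} + A.card = Nat.card E := by
        have := Fintype.card_subtype_compl (fun x => x ∈ A)
        have h3 := Finset.card_le_univ A
        simp only [Fintype.card_coe] at this
        rw [Nat.card_eq_fintype_card, Nat.card_eq_fintype_card, this]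
        omega
      have h3 : B.card < A.card := hA
      omega
    · rw [related_comp]
      constructor
      · intro h
        by_cases hx : x ∈ A
        · exact ⟨Sum.inl ⟨y, by simpa [B] using ⟨x, hx, h⟩⟩, rfl, h, hx⟩
        · exact ⟨Sum.inr ⟨x, hx⟩, h, rfl⟩
      · rintro ⟨b | z, h1, h2⟩
        · obtain rfl : y = b.1 := h1
          exact h2.1
        · obtain rfl : z.1 = x := h2
          exact h1

lemma subset_transClosure (S : Set (E × E)) : S ⊆ transClosure S :=
  fun _ h => Relation.TransGen.single h

lemma transClosure_trans (S : Set (E × E)) {x y z : E} (h : (x, y) ∈ transClosure S)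
    (h' : (y, z) ∈ transClosure S) : (x, z) ∈ transClosure S :=
  Relation.TransGen.trans h h'

lemma transClosure_subset {S T : Set (E × E)} (h : S ⊆ T)
    (hT : ∀ x y z, (x, y) ∈ T → (y, z) ∈ T → (x, z) ∈ T) : transClosure S ⊆ T := by
  rintro ⟨x, y⟩ hxy
  change Relation.TransGen _ x y at hxy
  induction hxy with
  | single h' => exact h h'
  | tail _ h' ih => exact hT _ _ _ ih (h h')

/-- A preorder is an order or is inessential. -/
lemma isInessential_or_isOrderRel (S : Set (E × E)) (hS : ∀ x, (x, x) ∈ S)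
    (hT : ∀ x y z, (x, y) ∈ S → (y, z) ∈ S → (x, z) ∈ S) :
    IsInessential (rel S) ∨ IsOrderRel S := by
  by_cases h : ∀ x y, (x, y) ∈ S → (y, x) ∈ S → x = y
  · exact Or.inr ⟨hS, h, hT⟩
  · left
    push Not at h
    obtain ⟨x, y, hxy, hyx, hne⟩ := h
    -- Since `x` and `y` are equivalent for the preorder, `y` can replace `x` as an intermediate
    -- point, so `x` may be dropped.
    refine ⟨⟨{z : E // z ≠ x}⟩, ofRel fun (z : {z : E // z ≠ x}) w => (z.1, w) ∈ S,
      ofRel fun w (z : {z : E // z ≠ x}) => (w, z.1) ∈ S, ?_, hom_ext fun z w => ?_⟩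
    · exact Finite.card_subtype_lt (x := x) (by simp)
    · rw [related_comp]
      constructor
      · intro h
        by_cases hw : w = x
        · subst hw
          exact ⟨⟨y, fun h' => hne h'.symm⟩, hT _ _ _ h hxy, hyx⟩
        · exact ⟨⟨w, hw⟩, h, hS w⟩
      · rintro ⟨v, h1, h2⟩
        exact hT _ _ _ h1 h2

/-- The discrete order. -/
def discreteOrder (E : FinCorr.{u}) : OrderRel E :=
  ⟨{p | p.1 = p.2}, ⟨fun _ => rfl, fun _ _ h _ => h, fun _ _ _ h h' => h.trans h'⟩⟩

lemma discreteOrder_le (R : OrderRel E) : discreteOrder E ≤ R := by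
  rintro ⟨x, y⟩ h
  obtain rfl : x = y := h
  exact R.2.refl x

lemma rel_discreteOrder : rel (discreteOrder E).1 = 1 := rfl

lemma mem_aut_of_conj_eq {R : OrderRel E} {σ : Equiv.Perm E} (h : OrderRel.conj σ R = R) :
    σ ∈ R.aut := by
  intro x y
  have := congrArg (fun S : OrderRel E => (σ x, σ y) ∈ S.1) h
  simp only [OrderRel.conj, RelIso.coe_fn_mk, Equiv.coe_fn_mk, Set.mem_ofPred_eq,
    Equiv.symm_apply_apply, eq_iff_iff] at this
  exact this.symm

lemma rel_mul_rel_of_le {S T : OrderRel E} (h : S ≤ T) : rel S.1 * rel T.1 = rel T.1 := by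
  refine hom_ext fun x z => ⟨?_, fun hz => ⟨x, S.2.refl x, hz⟩⟩
  rintro ⟨y, h1, h2⟩
  exact T.2.trans _ _ _ (h h1) h2

end Essential

end FinCorr

open FinCorr

/-! ## The algebra of permuted orders -/

section PermutedOrdersAlgebra

variable (k : Type u) [CommRing k] (E : FinCorr.{u})

variable {E} in
lemma relClass_eq_zero {Q : End E} (hQ : IsInessential Q) : relClass k E Q = 0 := by
  have := RingQuot.mkAlgHom_rel k (PermutedOrdersRel.inessential (k := k) Q hQ)
  rwa [map_zero] at this

variable {E} in
lemma relClass_transClosure {S : Set (E × E)} (hS : ∀ x, (x, x) ∈ S) :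
    relClass k E (rel S) = relClass k E (rel (transClosure S)) :=
  RingQuot.mkAlgHom_rel k (PermutedOrdersRel.reflexive (k := k) S hS)

variable {E}

/-- The class in `𝒫_E` of an order. -/
def orderClass (S : OrderRel E) : PermutedOrders k E := relClass k E (rel S.1)

lemma orderClass_discreteOrder : orderClass k (discreteOrder E) = 1 := by
  rw [orderClass, rel_discreteOrder, map_one]

/-- The transitive closure of `S` is either the least order containing `S`, or a preorder that is
not antisymmetric. The latter is inessential, and then no order contains `S`. -/
lemma relClass_reflexive {S : Set (E × E)} (hS : ∀ x, (x, x) ∈ S) :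
    (relClass k E (rel S) = 0 ∧ ¬ ∃ T : OrderRel E, S ⊆ T.1) ∨
      ∃ T : OrderRel E, relClass k E (rel S) = orderClass k T ∧
        ∀ U : OrderRel E, S ⊆ U.1 ↔ T ≤ U := by
  rw [relClass_transClosure k hS]
  by_cases h : IsOrderRel (transClosure S)
  · right
    refine ⟨⟨_, h⟩, rfl, fun U => ⟨fun hU => transClosure_subset hU U.2.trans, fun hU => ?_⟩⟩
    exact (subset_transClosure S).trans hU
  · left
    refine ⟨relClass_eq_zero k ((isInessential_or_isOrderRel _
      (fun x => subset_transClosure S (hS x))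
      (fun _ _ _ => transClosure_trans S)).resolve_right h), ?_⟩
    rintro ⟨T, hT⟩
    have hle := transClosure_subset hT T.2.trans
    exact h ⟨fun x => subset_transClosure S (hS x),
      fun x y h1 h2 => T.2.antisymm _ _ (hle h1) (hle h2), fun _ _ _ => transClosure_trans S⟩

lemma relClass_eq_zero_or (Q : End E) :
    relClass k E Q = 0 ∨ ∃ (σ : Equiv.Perm E) (T : OrderRel E),
      relClass k E Q = relClass k E (perm σ) * orderClass k T := by
  rcases isInessential_or_eq_perm_mul Q with h | ⟨σ, S, hS, rfl⟩
  · exact Or.inl (relClass_eq_zero k h)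
  · rw [map_mul]
    rcases relClass_reflexive k hS with ⟨h, -⟩ | ⟨T, hT, -⟩
    · left; rw [h, mul_zero]
    · right; exact ⟨σ, T, by rw [hT]⟩

open scoped Classical in
lemma fIdem_eq (R : OrderRel E) :
    fIdem k E R = ∑ S : OrderRel E with R ≤ S, IncidenceAlgebra.mu k R S • orderClass k S := rfl

-- Möbius inversion of the definition of `f_U`: after exchanging the sums, the coefficient of `S` is
-- the sum of `μ(U,S)` over `U` in `[T,S]`.
open scoped Classical in
lemma orderClass_eq_sum (T : OrderRel E) :
    orderClass k T = ∑ U : OrderRel E with T ≤ U, fIdem k E U := by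
  simp only [fIdem_eq, Finset.sum_filter]
  have h1 : ∀ U : OrderRel E, (if T ≤ U then ∑ S : OrderRel E, (if U ≤ S then
      IncidenceAlgebra.mu k U S • orderClass k S else 0) else 0) =
      ∑ S : OrderRel E, (if T ≤ U ∧ U ≤ S then IncidenceAlgebra.mu k U S else 0) •
        orderClass k S := by
    intro U
    split_ifs with h
    · refine Finset.sum_congr rfl fun S _ => ?_
      by_cases h' : U ≤ S <;> simp [h, h']
    · simp [h]
  simp only [h1]
  rw [Finset.sum_comm]
  simp only [← Finset.sum_smul, ← Finset.sum_filter]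
  have h2 : ∀ S : OrderRel E, (Finset.univ.filter fun U => T ≤ U ∧ U ≤ S) = Finset.Icc T S := by
    intro S; ext U; simp
  simp only [h2, IncidenceAlgebra.sum_Icc_mu_left]
  simp

lemma sum_fIdem : ∑ R : OrderRel E, fIdem k E R = 1 := by
  classical
  rw [← orderClass_discreteOrder, orderClass_eq_sum]
  simp [discreteOrder_le]

lemma orderClass_mul_orderClass_of_le {S T : OrderRel E} (h : S ≤ T) :
    orderClass k S * orderClass k T = orderClass k T := by
  rw [orderClass, orderClass, ← map_mul, rel_mul_rel_of_le h]

lemma orderClass_mul_fIdem_of_le {S R : OrderRel E} (h : S ≤ R) :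
    orderClass k S * fIdem k E R = fIdem k E R := by
  classical
  rw [fIdem_eq, Finset.mul_sum]
  refine Finset.sum_congr rfl fun T hT => ?_
  rw [mul_smul_comm, orderClass_mul_orderClass_of_le k (h.trans (Finset.mem_filter.mp hT).2)]

-- An order contains the composite `ST` exactly when it contains `S` and `T`. So the class of `ST`
-- is the join of `S` and `T`, or zero if they have no common upper bound; expanding in the `f_U`
-- covers both cases at once.
open scoped Classical in
lemma orderClass_mul_orderClass (S T : OrderRel E) :
    orderClass k S * orderClass k T = ∑ U : OrderRel E with S ≤ U ∧ T ≤ U, fIdem k E U := by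
  have hST : rel S.1 * rel T.1 = rel {p : E × E | Related (rel S.1 * rel T.1) p.1 p.2} := eq_rel _
  have hrefl : ∀ x, (x, x) ∈ {p : E × E | Related (rel S.1 * rel T.1) p.1 p.2} :=
    fun x => ⟨x, S.2.refl x, T.2.refl x⟩
  have hle : ∀ U : OrderRel E, {p : E × E | Related (rel S.1 * rel T.1) p.1 p.2} ⊆ U.1 ↔
      S ≤ U ∧ T ≤ U := by
    intro U
    constructor
    · intro h
      exact ⟨fun ⟨x, y⟩ hxy => h (a := (x, y)) ⟨y, hxy, T.2.refl y⟩,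
        fun ⟨x, y⟩ hxy => h (a := (x, y)) ⟨x, S.2.refl x, hxy⟩⟩
    · rintro ⟨h1, h2⟩ ⟨x, z⟩ ⟨y, hy, hy'⟩
      exact U.2.trans _ _ _ (h1 hy) (h2 hy')
  rw [orderClass, orderClass, ← map_mul, hST]
  rcases relClass_reflexive k hrefl with ⟨h, h'⟩ | ⟨V, hV, hV'⟩
  · rw [h, Finset.sum_eq_zero]
    intro U hU
    exact absurd ⟨U, (hle U).mpr (Finset.mem_filter.mp hU).2⟩ h'
  · rw [hV, orderClass_eq_sum]
    exact Finset.sum_congr (Finset.filter_congr fun U _ => by rw [← hV', hle]) fun _ _ => rfl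

lemma orderClass_mul_fIdem_of_not_le {S R : OrderRel E} (h : ¬ S ≤ R) :
    orderClass k S * fIdem k E R = 0 := by
  classical
  -- Induction from the maximal orders downwards. Expand `S · R` as `S f_R` plus the terms `S f_U`
  -- with `U > R`, known by induction; as `S ≰ R`, every common upper bound of `S` and `R` is
  -- strictly above `R`, so these terms already give the whole product and `S f_R = 0`.
  induction R using WellFoundedGT.induction with
  | ind R ih =>
    have h1 := orderClass_mul_orderClass k S R
    have h2 : (Finset.univ.filter fun U => R ≤ U) =
        insert R (Finset.univ.filter fun U : OrderRel E => R < U) := by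
      ext U; simp [le_iff_eq_or_lt, eq_comm]
    rw [orderClass_eq_sum k R, h2, Finset.sum_insert (by simp), mul_add] at h1
    have h3 : orderClass k S * ∑ U : OrderRel E with R < U, fIdem k E U =
        ∑ U : OrderRel E with S ≤ U ∧ R ≤ U, fIdem k E U := by
      rw [Finset.mul_sum]
      have h4 : (Finset.univ.filter fun U => S ≤ U ∧ R ≤ U) =
          (Finset.univ.filter fun U : OrderRel E => R < U).filter fun U => S ≤ U := by
        ext U
        simp only [Finset.mem_filter, Finset.mem_univ, true_and]
        refine ⟨fun ⟨h1, h2⟩ => ⟨lt_of_le_of_ne h2 ?_, h1⟩, fun ⟨h1, h2⟩ => ⟨h2, h1.le⟩⟩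
        rintro rfl
        exact h h1
      rw [h4, Finset.sum_filter (fun U => S ≤ U)]
      refine Finset.sum_congr rfl fun U hU => ?_
      split_ifs with hSU
      · exact orderClass_mul_fIdem_of_le k hSU
      · exact ih U (Finset.mem_filter.mp hU).2 hSU
    rw [h3] at h1
    simpa using h1

open scoped Classical in
lemma orderClass_mul_fIdem (S R : OrderRel E) :
    orderClass k S * fIdem k E R = if S ≤ R then fIdem k E R else 0 := by
  split_ifs with h
  · exact orderClass_mul_fIdem_of_le k h
  · exact orderClass_mul_fIdem_of_not_le k h

open scoped Classical in
lemma fIdem_mul_fIdem (S R : OrderRel E) :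
    fIdem k E S * fIdem k E R = if S = R then fIdem k E R else 0 := by
  rw [fIdem_eq k S, Finset.sum_mul]
  simp only [smul_mul_assoc, orderClass_mul_fIdem, smul_ite, smul_zero]
  rw [← Finset.sum_filter, Finset.filter_filter, ← Finset.sum_smul]
  have h2 : (Finset.univ.filter fun U => S ≤ U ∧ U ≤ R) = Finset.Icc S R := by
    ext U; simp
  rw [h2, IncidenceAlgebra.sum_Icc_mu_right]
  split_ifs <;> simp

lemma fIdem_mul_self (R : OrderRel E) : fIdem k E R * fIdem k E R = fIdem k E R := by
  classical
  rw [fIdem_mul_fIdem, if_pos rfl]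

lemma relClass_mul_fIdem (Q : End E) (R : OrderRel E) :
    relClass k E Q * fIdem k E R = 0 ∨ ∃ σ : Equiv.Perm E,
      relClass k E Q * fIdem k E R = relClass k E (perm σ) * fIdem k E R := by
  classical
  rcases relClass_eq_zero_or k Q with h | ⟨σ, T, h⟩
  · left; rw [h, zero_mul]
  · rw [h, mul_assoc, orderClass_mul_fIdem]
    split_ifs
    · exact Or.inr ⟨σ, rfl⟩
    · exact Or.inl (mul_zero _)

lemma fIdem_mul_perm_mul_fIdem (S R : OrderRel E) (σ : Equiv.Perm E)
    (h : OrderRel.conj σ R ≠ S) :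
    fIdem k E S * (relClass k E (perm σ) * fIdem k E R) = 0 := by
  classical
  rw [← fIdem_conj, ← mul_assoc, fIdem_mul_fIdem, if_neg (Ne.symm h), zero_mul]

/-- `Q f_R` is zero or `Δ_σ f_R = f_{σR} Δ_σ`, and orthogonality lets `f_S` keep the latter only if
`σR = S`. For `S = R` the permutation is an automorphism, so `f_R 𝒫_E f_R` is spanned by the `Δ_σ
f_R` with `σ` in `Aut(E,R)`. -/
lemma fIdem_mul_relClass_mul_fIdem (S R : OrderRel E) (Q : End E) :
    fIdem k E S * (relClass k E Q * fIdem k E R) = 0 ∨ ∃ σ : Equiv.Perm E,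
      OrderRel.conj σ R = S ∧
      fIdem k E S * (relClass k E Q * fIdem k E R) = relClass k E (perm σ) * fIdem k E R := by
  classical
  rcases relClass_mul_fIdem k Q R with h | ⟨σ, h⟩
  · left; rw [h, mul_zero]
  · rw [h]
    by_cases hσ : OrderRel.conj σ R = S
    · right
      refine ⟨σ, hσ, ?_⟩
      rw [← fIdem_conj, ← mul_assoc, hσ, fIdem_mul_self]
    · exact Or.inl (fIdem_mul_perm_mul_fIdem k S R σ hσ)

end PermutedOrdersAlgebra

/-! ## Representations which factor through the algebra of permuted orders -/

section OrderRepresentations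

variable {k : Type u} [CommRing k] {E : FinCorr.{u}} {W : Type u} [AddCommGroup W] [Module k W]
  {ρ : Representation k (End E) W}

/-- The representation `ρ` factors through the algebra of permuted orders. -/
structure FactorsThroughOrders (ρ : Representation k (End E) W) : Prop where
  inessential : ∀ Q : End E, IsInessential Q → ρ Q = 0
  reflexive : ∀ S : Set (E × E), (∀ x, (x, x) ∈ S) → ρ (rel S) = ρ (rel (transClosure S))

/-- The action of the algebra of permuted orders on a representation which factors through it. -/
def FactorsThroughOrders.action (h : FactorsThroughOrders ρ) :
    PermutedOrders k E →ₐ[k] Module.End k W :=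
  RingQuot.liftAlgHom k ⟨MonoidAlgebra.lift k (Module.End k W) (End E) ρ, by
    rintro _ _ (⟨Q, hQ⟩ | ⟨S, hS⟩)
    · rw [MonoidAlgebra.lift_of, map_zero, h.inessential Q hQ]
    · rw [MonoidAlgebra.lift_of, MonoidAlgebra.lift_of, h.reflexive S hS]⟩

@[simp]
lemma FactorsThroughOrders.action_relClass (h : FactorsThroughOrders ρ) (Q : End E) :
    h.action (relClass k E Q) = ρ Q := by
  simp only [action, relClass, MonoidHom.comp_apply]
  exact (RingQuot.liftAlgHom_mkAlgHom_apply ..).trans (MonoidAlgebra.lift_of _ _)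

lemma FactorsThroughOrders.action_orderClass (h : FactorsThroughOrders ρ) (S : OrderRel E) :
    h.action (orderClass k S) = ρ (rel S.1) := h.action_relClass _

/-- The algebra of permuted orders is spanned by the classes of relations. -/
lemma PermutedOrders.induction {p : PermutedOrders k E → Prop} (x : PermutedOrders k E)
    (rel : ∀ Q, p (relClass k E Q)) (add : ∀ x y, p x → p y → p (x + y))
    (smul : ∀ (c : k) x, p x → p (c • x)) : p x := by
  obtain ⟨y, rfl⟩ := RingQuot.mkAlgHom_surjective k (PermutedOrdersRel k E) x
  induction y using MonoidAlgebra.induction_on with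
  | of Q => exact rel Q
  | add x y hx hy => rw [map_add]; exact add _ _ hx hy
  | smul c x hx => rw [map_smul]; exact smul _ _ hx

/-- The component of a representation attached to an order `R`: the elements which are fixed by
the orders contained in `R` and killed by the other orders. -/
def orderComponent (ρ : Representation k (End E) W) (R : OrderRel E) : Submodule k W where
  carrier := {w | ∀ S : OrderRel E, (S ≤ R → ρ (rel S.1) w = w) ∧ (¬ S ≤ R → ρ (rel S.1) w = 0)}
  zero_mem' S := by simp
  add_mem' {v w} hv hw S :=
    ⟨fun h => by rw [map_add, (hv S).1 h, (hw S).1 h],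
      fun h => by rw [map_add, (hv S).2 h, (hw S).2 h, add_zero]⟩
  smul_mem' c w hw S :=
    ⟨fun h => by rw [map_smul, (hw S).1 h], fun h => by rw [map_smul, (hw S).2 h, smul_zero]⟩

lemma mem_orderComponent {R : OrderRel E} {w : W} :
    w ∈ orderComponent ρ R ↔
      ∀ S : OrderRel E, (S ≤ R → ρ (rel S.1) w = w) ∧ (¬ S ≤ R → ρ (rel S.1) w = 0) := Iff.rfl

namespace FactorsThroughOrders

variable (h : FactorsThroughOrders ρ)
include h

lemma action_fIdem_mem (R : OrderRel E) (w : W) :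
    h.action (fIdem k E R) w ∈ orderComponent ρ R := by
  refine mem_orderComponent.mpr fun S => ⟨fun hS => ?_, fun hS => ?_⟩
  · rw [← h.action_orderClass, ← Module.End.mul_apply, ← map_mul,
      orderClass_mul_fIdem_of_le k hS]
  · rw [← h.action_orderClass, ← Module.End.mul_apply, ← map_mul,
      orderClass_mul_fIdem_of_not_le k hS, map_zero, LinearMap.zero_apply]

open scoped Classical in
lemma action_fIdem_of_mem {R : OrderRel E} {w : W} (hw : w ∈ orderComponent ρ R)
    (S : OrderRel E) : h.action (fIdem k E S) w = if S = R then w else 0 := by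
  have h1 : ∀ T : OrderRel E, h.action (orderClass k T) w = if T ≤ R then w else 0 := by
    intro T
    rw [h.action_orderClass]
    split_ifs with hT
    · exact (hw T).1 hT
    · exact (hw T).2 hT
  simp only [fIdem_eq, map_sum, map_smul, LinearMap.sum_apply, LinearMap.smul_apply, h1, smul_ite,
    smul_zero]
  rw [← Finset.sum_filter, Finset.filter_filter, ← Finset.sum_smul]
  have h2 : (Finset.univ.filter fun U => S ≤ U ∧ U ≤ R) = Finset.Icc S R := by
    ext U; simp
  rw [h2, IncidenceAlgebra.sum_Icc_mu_right]
  split_ifs <;> simp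

/-- The component is the image of the idempotent `f_R`. Its definition through the action of orders
alone makes sense for any representation, which is convenient when transporting it along bijections
and isomorphisms. -/
lemma mem_orderComponent_iff {R : OrderRel E} {w : W} :
    w ∈ orderComponent ρ R ↔ h.action (fIdem k E R) w = w := by
  classical
  refine ⟨fun hw => ?_, fun hw => hw ▸ h.action_fIdem_mem R w⟩
  rw [h.action_fIdem_of_mem hw, if_pos rfl]

lemma exists_action_fIdem_ne_zero {w : W} (hw : w ≠ 0) :
    ∃ R : OrderRel E, h.action (fIdem k E R) w ≠ 0 := by
  by_contra! hc
  refine hw ?_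
  have := congrArg (fun x => h.action x w) (sum_fIdem k (E := E))
  simpa [hc] using this.symm

lemma action_fIdem_relClass {S R : OrderRel E} {w : W} (hw : w ∈ orderComponent ρ R)
    (Q : End E) : h.action (fIdem k E S) (ρ Q w) =
      h.action (fIdem k E S * (relClass k E Q * fIdem k E R)) w := by
  rw [map_mul, map_mul, Module.End.mul_apply, Module.End.mul_apply, h.action_relClass,
    h.mem_orderComponent_iff.mp hw]

lemma perm_mem {R : OrderRel E} {w : W} (hw : w ∈ orderComponent ρ R) (σ : Equiv.Perm E) :
    ρ (perm σ) w ∈ orderComponent ρ (OrderRel.conj σ R) := by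
  rw [h.mem_orderComponent_iff, ← h.action_relClass, ← Module.End.mul_apply, ← map_mul,
    fIdem_conj, map_mul, Module.End.mul_apply, h.mem_orderComponent_iff.mp hw]

end FactorsThroughOrders

end OrderRepresentations

/-! ## A representation on the free module on the permutations -/

section PermRep

variable {E : FinCorr.{u}}

/-- The relation `Q` satisfies `Δ_τ ⊆ Q ⊆ Δ_τ T`. -/
structure IsPermPart (T : OrderRel E) (Q : End E) (τ : Equiv.Perm E) : Prop where
  related : ∀ x, Related Q (τ x) x
  mem : ∀ y x, Related Q y x → (τ.symm y, x) ∈ T.1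

/-- Testing each inclusion on the diagonal of the other permutation puts both `(τ'⁻¹τx, x)` and `(x,
τ'⁻¹τx)` in `T`. -/
lemma IsPermPart.unique {T : OrderRel E} {Q : End E} {τ τ' : Equiv.Perm E}
    (h : IsPermPart T Q τ) (h' : IsPermPart T Q τ') : τ = τ' := by
  refine Equiv.ext fun x => ?_
  have h1 := h'.mem _ _ (h.related x)
  have h2 := h.mem _ _ (h'.related (τ'.symm (τ x)))
  simp only [Equiv.apply_symm_apply, Equiv.symm_apply_apply] at h2
  exact (Equiv.symm_apply_eq τ').mp (T.2.antisymm _ _ h1 h2)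

lemma IsPermPart.mul {T : OrderRel E} {Q Q' : End E} {τ τ' : Equiv.Perm E}
    (h' : IsPermPart T Q' τ') (h : IsPermPart (OrderRel.conj τ' T) Q τ) :
    IsPermPart T (Q * Q') (τ * τ') := by
  refine ⟨fun x => ⟨τ' x, h.related _, h'.related _⟩, ?_⟩
  rintro y x ⟨z, h1, h2⟩
  exact T.2.trans _ _ _ (h.mem _ _ h1) (h'.mem _ _ h2)

/-- If a composite of two correspondences contains the diagonal of a permutation and is contained
in the corresponding translate of an order, then the intermediate elements are unique. -/
lemma IsPermPart.exists_injective {X : FinCorr.{u}} {T : OrderRel E} {A : E ⟶ X} {B : X ⟶ E}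
    {τ : Equiv.Perm E} (h : IsPermPart T (A ≫ B : E ⟶ E) τ) :
    ∃ f : E → X, Function.Injective f ∧ ∀ x, Related B (τ x) (f x) ∧ Related A (f x) x := by
  choose f hf using h.related
  refine ⟨f, fun x x' hx => ?_, hf⟩
  have h1 := h.mem (τ x) x' ⟨f x, (hf x).1, hx ▸ (hf x').2⟩
  have h2 := h.mem (τ x') x ⟨f x', (hf x').1, hx ▸ (hf x).2⟩
  rw [Equiv.symm_apply_apply] at h1 h2
  exact T.2.antisymm _ _ h1 h2

/-- The intermediate points of `Δ_π ⊆ QQ'` form an injective map, hence a permutation `τ'`, and `τ =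
πτ'⁻¹`. This converse of `IsPermPart.mul` gives multiplicativity of `permRep` where one of the
factors acts by zero. -/
lemma IsPermPart.exists_of_mul {T : OrderRel E} {Q Q' : End E} {π : Equiv.Perm E}
    (h : IsPermPart T (Q * Q') π) :
    ∃ τ' τ : Equiv.Perm E, IsPermPart T Q' τ' ∧ IsPermPart (OrderRel.conj τ' T) Q τ := by
  obtain ⟨f, hf, hQ⟩ := IsPermPart.exists_injective h
  let τ' : Equiv.Perm E := Equiv.ofBijective f (Finite.injective_iff_bijective.mp hf)
  refine ⟨τ', π * τ'⁻¹, ⟨fun x => (hQ x).2, fun y x hyx => ?_⟩, ⟨fun x => ?_, fun y x hyx => ?_⟩⟩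
  · have := h.mem (π (τ'.symm y)) x ⟨y, ?_, hyx⟩
    · simpa using this
    · have := (hQ (τ'.symm y)).1
      rwa [show f (τ'.symm y) = y from τ'.apply_symm_apply y] at this
  · have := (hQ (τ'.symm x)).1
    rwa [show f (τ'.symm x) = x from τ'.apply_symm_apply x] at this
  · have := h.mem y (τ'.symm x) ⟨x, hyx, ?_⟩
    · change (τ'.symm ((π * τ'⁻¹).symm y), τ'.symm x) ∈ T.1
      have h2 : τ'.symm ((π * τ'⁻¹).symm y) = π.symm y := by
        rw [Equiv.symm_apply_eq, Equiv.symm_apply_eq]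
        simp
      rwa [h2]
    · have := (hQ (τ'.symm x)).2
      rwa [show f (τ'.symm x) = x from τ'.apply_symm_apply x] at this

lemma perm_eq_one_of_mem (T : OrderRel E) (π : Equiv.Perm E) (h : ∀ x, (π x, x) ∈ T.1) : π = 1 := by
  have h1 : ∀ (n : ℕ) x, ((π ^ n : Equiv.Perm E) x, x) ∈ T.1 := by
    intro n x
    induction n with
    | zero => exact T.2.refl _
    | succ n ih =>
      rw [pow_succ']
      exact T.2.trans _ _ _ (h _) ih
  -- With `n + 1` the order of `π`, the chain from `π x` to `π^n (π x) = x` gives `(x, π x) ∈ T`,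
  -- the reverse of the hypothesis.
  obtain ⟨n, hn⟩ := Nat.exists_eq_succ_of_ne_zero (orderOf_pos π).ne'
  have h2 : π ^ n * π = 1 := by rw [← pow_succ, ← Nat.succ_eq_add_one, ← hn, pow_orderOf_eq_one]
  refine Equiv.ext fun x => T.2.antisymm _ _ (h x) ?_
  have h3 : (π ^ n : Equiv.Perm E) (π x) = x := congrArg (fun σ : Equiv.Perm E => σ x) h2
  have h4 := h1 n (π x)
  rwa [h3] at h4

lemma isPermPart_rel {T : OrderRel E} {S : Set (E × E)} (hS : ∀ x, (x, x) ∈ S)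
    {τ : Equiv.Perm E} : IsPermPart T (rel S) τ ↔ τ = 1 ∧ S ⊆ T.1 := by
  constructor
  · intro h
    obtain rfl : τ = 1 := inv_eq_one.mp (perm_eq_one_of_mem T τ⁻¹ fun x => h.mem _ _ (hS x))
    exact ⟨rfl, fun ⟨y, x⟩ hyx => h.mem y x hyx⟩
  · rintro ⟨rfl, h⟩
    exact ⟨hS, fun y x hyx => h hyx⟩

lemma isPermPart_perm (T : OrderRel E) (τ : Equiv.Perm E) : IsPermPart T (perm τ) τ := by
  refine ⟨fun x => rfl, ?_⟩
  rintro y x (rfl : y = τ x)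
  rw [Equiv.symm_apply_apply]
  exact T.2.refl x

lemma OrderRel.conj_mul (σ τ : Equiv.Perm E) (R : OrderRel E) :
    OrderRel.conj (σ * τ) R = OrderRel.conj σ (OrderRel.conj τ R) := rfl

variable (k : Type u) [CommRing k] (R : OrderRel E)

open scoped Classical in
/-- The action of a relation on the free module on the permutations of `E`. -/
def permRepMap (Q : End E) : (Equiv.Perm E →₀ k) →ₗ[k] (Equiv.Perm E →₀ k) :=
  Finsupp.lsum k fun σ => if h : ∃ τ, IsPermPart (OrderRel.conj σ R) Q τ then
    Finsupp.lsingle (h.choose * σ) else 0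

variable {R} in
lemma permRepMap_single {Q : End E} {σ τ : Equiv.Perm E} (h : IsPermPart (OrderRel.conj σ R) Q τ)
    (c : k) : permRepMap k R Q (Finsupp.single σ c) = Finsupp.single (τ * σ) c := by
  have h' : ∃ τ, IsPermPart (OrderRel.conj σ R) Q τ := ⟨τ, h⟩
  rw [permRepMap, Finsupp.lsum_single, dif_pos h', h'.choose_spec.unique h]
  rfl

variable {R} in
lemma permRepMap_single_eq_zero {Q : End E} {σ : Equiv.Perm E}
    (h : ¬ ∃ τ, IsPermPart (OrderRel.conj σ R) Q τ) (c : k) :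
    permRepMap k R Q (Finsupp.single σ c) = 0 := by
  rw [permRepMap, Finsupp.lsum_single, dif_neg h]
  rfl

/-- The representation on the free module on the permutations of `E`, in which `Q` maps `σ` to
`τσ` if `Δ_τ ⊆ Q ⊆ Δ_τ (σR)`, and to zero if there is no such `τ`. -/
def permRep : Representation k (End E) (Equiv.Perm E →₀ k) where
  toFun := permRepMap k R
  map_one' := by
    refine Finsupp.lhom_ext fun σ c => ?_
    have h : IsPermPart (OrderRel.conj σ R) (1 : End E) 1 := isPermPart_perm _ 1
    rw [permRepMap_single k h, one_mul, Module.End.one_apply]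
  map_mul' Q Q' := by
    refine Finsupp.lhom_ext fun σ c => ?_
    rw [Module.End.mul_apply]
    by_cases h' : ∃ τ', IsPermPart (OrderRel.conj σ R) Q' τ'
    · obtain ⟨τ', h'⟩ := h'
      rw [permRepMap_single k h']
      by_cases h : ∃ τ, IsPermPart (OrderRel.conj (τ' * σ) R) Q τ
      · obtain ⟨τ, h⟩ := h
        rw [permRepMap_single k h, permRepMap_single k (h'.mul h), mul_assoc]
      · rw [permRepMap_single_eq_zero k h, permRepMap_single_eq_zero]
        rintro ⟨π, hπ⟩
        obtain ⟨τ₁, τ, h1, h2⟩ := hπ.exists_of_mul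
        obtain rfl := h1.unique h'
        exact h ⟨τ, h2⟩
    · rw [permRepMap_single_eq_zero k h', map_zero, permRepMap_single_eq_zero]
      rintro ⟨π, hπ⟩
      obtain ⟨τ₁, τ, h1, h2⟩ := hπ.exists_of_mul
      exact h' ⟨τ₁, h1⟩

lemma permRep_apply (Q : End E) : permRep k R Q = permRepMap k R Q := rfl

/-- Factoring through a smaller set would give an injection of `E` into it, so an inessential
relation has no permutation part. A reflexive relation can only have the identity as permutation
part, precisely when it lies in `σR`, and its closure lies in the same orders. -/
lemma factorsThroughOrders_permRep : FactorsThroughOrders (permRep k R) where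
  inessential Q hQ := by
    obtain ⟨Y, A, B, hY, rfl⟩ := hQ
    refine Finsupp.lhom_ext fun σ c => permRepMap_single_eq_zero k ?_ c
    rintro ⟨τ, h⟩
    obtain ⟨f, hf, -⟩ := h.exists_injective
    exact hY.not_ge (Nat.card_le_card_of_injective f hf)
  reflexive S hS := by
    refine Finsupp.lhom_ext fun σ c => ?_
    have hS' : ∀ x, (x, x) ∈ transClosure S := fun x => subset_transClosure S (hS x)
    have hle : S ⊆ (OrderRel.conj σ R).1 ↔ transClosure S ⊆ (OrderRel.conj σ R).1 :=
      ⟨fun h => transClosure_subset h (OrderRel.conj σ R).2.trans,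
        fun h => (subset_transClosure S).trans h⟩
    simp only [permRep_apply]
    by_cases h : S ⊆ (OrderRel.conj σ R).1
    · rw [permRepMap_single k ((isPermPart_rel hS).mpr ⟨rfl, h⟩),
        permRepMap_single k ((isPermPart_rel hS').mpr ⟨rfl, hle.mp h⟩)]
    · rw [permRepMap_single_eq_zero, permRepMap_single_eq_zero]
      · rintro ⟨τ, hτ⟩
        exact h (hle.mpr ((isPermPart_rel hS').mp hτ).2)
      · rintro ⟨τ, hτ⟩
        exact h ((isPermPart_rel hS).mp hτ).2

lemma permRep_perm (τ σ : Equiv.Perm E) (c : k) :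
    permRep k R (perm τ) (Finsupp.single σ c) = Finsupp.single (τ * σ) c :=
  permRepMap_single k (isPermPart_perm _ τ) c

lemma permRep_order (S : OrderRel E) (c : k) :
    (S ≤ R → permRep k R (rel S.1) (Finsupp.single 1 c) = Finsupp.single 1 c) ∧
    (¬ S ≤ R → permRep k R (rel S.1) (Finsupp.single 1 c) = 0) := by
  refine ⟨fun h => ?_, fun h => permRepMap_single_eq_zero k ?_ c⟩
  · rw [permRep_apply, permRepMap_single k (τ := 1), one_mul]
    exact (isPermPart_rel S.2.refl).mpr ⟨rfl, h⟩
  · rintro ⟨τ, hτ⟩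
    exact h ((isPermPart_rel S.2.refl).mp hτ).2

lemma single_one_mem_orderComponent (c : k) :
    Finsupp.single 1 c ∈ orderComponent (permRep k R) R :=
  mem_orderComponent.mpr fun S => permRep_order k R S c

variable {R} in
/-- Right multiplication by the automorphisms of `R` commutes with the action. -/
lemma permRep_mul_right (Q : End E) (b : R.aut) (u : Equiv.Perm E →₀ k) :
    permRep k R Q (Finsupp.mapDomain (· * b.1) u) =
      Finsupp.mapDomain (· * b.1) (permRep k R Q u) := by
  induction u using Finsupp.induction_linear with
  | zero => simp
  | add u v hu hv => simp only [map_add, Finsupp.mapDomain_add, hu, hv]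
  | single σ c =>
    have hb : OrderRel.conj (σ * b.1) R = OrderRel.conj σ R := by
      rw [OrderRel.conj_mul, R.conj_eq_self b.2]
    rw [Finsupp.mapDomain_single, permRep_apply]
    by_cases h : ∃ τ, IsPermPart (OrderRel.conj σ R) Q τ
    · obtain ⟨τ, h⟩ := h
      rw [permRepMap_single k h, permRepMap_single k (hb.symm ▸ h), Finsupp.mapDomain_single,
        mul_assoc]
    · rw [permRepMap_single_eq_zero k h, permRepMap_single_eq_zero k (hb.symm ▸ h),
        Finsupp.mapDomain_zero]

end PermRep

/-! ## Irreducible representations -/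

lemma Representation.isIrreducible_iff_submodule {k G W : Type*} [Field k] [Monoid G]
    [AddCommGroup W] [Module k W] (ρ : Representation k G W) :
    ρ.IsIrreducible ↔ Nontrivial W ∧ ∀ N : Submodule k W, (∀ g, ∀ w ∈ N, ρ g w ∈ N) →
      N = ⊥ ∨ N = ⊤ := by
  constructor
  · intro h
    refine ⟨?_, fun N hN => ?_⟩
    · by_contra hW
      rw [not_nontrivial_iff_subsingleton] at hW
      refine bot_ne_top (α := Subrepresentation ρ)
        (Subrepresentation.toSubmodule_injective (Subsingleton.elim _ _))
    · rcases eq_bot_or_eq_top (⟨N, fun g w hw => hN g w hw⟩ : Subrepresentation ρ) with h | h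
      · exact Or.inl (congrArg Subrepresentation.toSubmodule h)
      · exact Or.inr (congrArg Subrepresentation.toSubmodule h)
  · rintro ⟨h, hN⟩
    refine { exists_pair_ne := ⟨⊥, ⊤, fun h => ?_⟩, eq_bot_or_eq_top := fun N => ?_ }
    · have : (⊥ : Submodule k W) = ⊤ := congrArg Subrepresentation.toSubmodule h
      exact bot_ne_top this
    · rcases hN N.toSubmodule fun g w hw => N.apply_mem_toSubmodule g hw with h | h
      · exact Or.inl (Subrepresentation.toSubmodule_injective h)
      · exact Or.inr (Subrepresentation.toSubmodule_injective h)

lemma BalancedTensor.induction {k : Type u} [CommRing k] {M A B : Type u} [Monoid M]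
    [AddCommGroup A] [Module k A] [AddCommGroup B] [Module k B]
    {r : Representation k Mᵐᵒᵖ A} {l : Representation k M B}
    {p : BalancedTensor r l → Prop} (z : BalancedTensor r l)
    (tmul : ∀ a b, p (BalancedTensor.tmul r l a b)) (add : ∀ x y, p x → p y → p (x + y)) : p z := by
  obtain ⟨z, rfl⟩ := Submodule.mkQ_surjective _ z
  induction z using TensorProduct.induction_on with
  | zero => simpa [BalancedTensor.tmul] using tmul 0 0
  | tmul a b => exact tmul a b
  | add x y hx hy => rw [map_add]; exact add _ _ hx hy

section BalancedTensorLemmas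

variable {k : Type u} [CommRing k] {M A B : Type u} [Monoid M]
    [AddCommGroup A] [Module k A] [AddCommGroup B] [Module k B]
    (r : Representation k Mᵐᵒᵖ A) (l : Representation k M B)

/-- The canonical bilinear map to the balanced tensor product. -/
def BalancedTensor.mk : A →ₗ[k] B →ₗ[k] BalancedTensor r l :=
  (TensorProduct.mk k A B).compr₂ (balancedSubmodule r l).mkQ

/-- The bilinear map `(x, b) ↦ F x ⊗ b`. -/
def BalancedTensor.mkComp {C : Type u} [AddCommMonoid C] [Module k C] (F : C →ₗ[k] A) :
    C →ₗ[k] B →ₗ[k] BalancedTensor r l := (BalancedTensor.mk r l).comp F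

lemma BalancedTensor.tmul_smul_right (a : A) (m : M) (b : B) :
    BalancedTensor.tmul r l (r (MulOpposite.op m) a) b = BalancedTensor.tmul r l a (l m b) := by
  refine (Submodule.Quotient.eq _).mpr (Submodule.subset_span ⟨a, m, b, rfl⟩)

variable {r} in
lemma BalancedTensor.mkComp_balanced {C : Type u} [AddCommMonoid C] [Module k C] (F : C →ₗ[k] A)
    {x y : C} {m : M} (h : r (MulOpposite.op m) (F x) = F y) (b : B) :
    BalancedTensor.mkComp r l F y b = BalancedTensor.mkComp r l F x (l m b) :=
  (congrArg (fun a => BalancedTensor.tmul r l a b) h.symm).trans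
    (BalancedTensor.tmul_smul_right r l (F x) m b)

end BalancedTensorLemmas

/-! ## Modules induced from the automorphism group of an order -/

section Induced

variable {k : Type u} [CommRing k] {E : FinCorr.{u}} {R : OrderRel E} {V : Type u}
  [AddCommGroup V] [Module k V] {ρ : Representation k R.aut V}
  {T : Type u} [AddCommGroup T] [Module k T] {τ : Representation k (End E) T}
  {t : PermutedOrders k E →ₗ[k] V →ₗ[k] T}

/-- The map `t`, `(x, v) ↦ x f_R ⊗ v`, exhibits `τ` as the module `𝒫_E f_R ⊗_{k Aut(E,R)} V`. -/
structure IsInduced (ρ : Representation k R.aut V) (τ : Representation k (End E) T)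
    (t : PermutedOrders k E →ₗ[k] V →ₗ[k] T) : Prop where
  apply_rel : ∀ Q x v, τ Q (t x v) = t (relClass k E Q * x) v
  congr : ∀ x y v, x * fIdem k E R = y * fIdem k E R → t x v = t y v
  perm : ∀ (σ : R.aut) v, t (relClass k E (perm σ.1)) v = t 1 (ρ σ v)
  span : ∀ N : Submodule k T, (∀ x v, t x v ∈ N) → N = ⊤
  injective : Function.Injective (t 1)

namespace IsInduced

variable (ht : IsInduced ρ τ t)
include ht

lemma span_rel (N : Submodule k T) (h : ∀ Q v, t (relClass k E Q) v ∈ N) : N = ⊤ := by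
  refine ht.span N fun x => ?_
  induction x using PermutedOrders.induction with
  | rel Q => exact h Q
  | add x y hx hy => intro v; rw [map_add]; exact add_mem (hx v) (hy v)
  | smul c x hx => intro v; rw [map_smul]; exact N.smul_mem c (hx v)

lemma linearMap_ext {T' : Type u} [AddCommGroup T'] [Module k T'] {f g : T →ₗ[k] T'}
    (h : ∀ Q v, f (t (relClass k E Q) v) = g (t (relClass k E Q) v)) : f = g :=
  LinearMap.ext fun z => by
    have := ht.span_rel (LinearMap.eqLocus f g) h
    exact (this ▸ Submodule.mem_top : z ∈ LinearMap.eqLocus f g)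

lemma factorsThroughOrders : FactorsThroughOrders τ where
  inessential Q hQ := ht.linearMap_ext fun Q' v => by
    rw [ht.apply_rel, relClass_eq_zero k hQ, zero_mul, map_zero]
    rfl
  reflexive S hS := ht.linearMap_ext fun Q' v => by
    rw [ht.apply_rel, ht.apply_rel, relClass_transClosure k hS]

lemma action_apply (x y : PermutedOrders k E) (v : V) :
    ht.factorsThroughOrders.action x (t y v) = t (x * y) v := by
  induction x using PermutedOrders.induction with
  | rel Q => rw [FactorsThroughOrders.action_relClass, ht.apply_rel]
  | add x x' hx hx' => rw [map_add, LinearMap.add_apply, hx, hx', add_mul, map_add]; rfl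
  | smul c x hx => rw [map_smul, LinearMap.smul_apply, hx, smul_mul_assoc, map_smul]; rfl

lemma perm_apply (a : R.aut) (v : V) : τ (FinCorr.perm a.1) (t 1 v) = t 1 (ρ a v) := by
  rw [ht.apply_rel, mul_one, ht.perm]

lemma mem_orderComponent (v : V) : t 1 v ∈ orderComponent τ R := by
  rw [ht.factorsThroughOrders.mem_orderComponent_iff, ht.action_apply]
  exact ht.congr _ _ _ (by rw [mul_one, one_mul, fIdem_mul_self])

/-- On a generator `Q f_R ⊗ v` the idempotent `f_R` gives zero or `Δ_σ f_R ⊗ v = f_R ⊗ σv` with `σ`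
in `Aut(E,R)`. -/
lemma action_fIdem_mem_range (z : T) :
    ht.factorsThroughOrders.action (fIdem k E R) z ∈ LinearMap.range (t 1) := by
  suffices h : (LinearMap.range (t 1)).comap (ht.factorsThroughOrders.action (fIdem k E R)) = ⊤ by
    exact (h ▸ Submodule.mem_top : z ∈ (LinearMap.range (t 1)).comap _)
  refine ht.span_rel _ fun Q v => ?_
  rw [Submodule.mem_comap, ht.action_apply]
  rcases fIdem_mul_relClass_mul_fIdem k R R Q with h | ⟨σ, hσ, h⟩
  · rw [ht.congr _ 0 v (by rw [mul_assoc, h, zero_mul]), map_zero]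
    exact zero_mem _
  · rw [ht.congr _ (relClass k E (FinCorr.perm σ)) v (by rw [mul_assoc, h])]
    exact ⟨ρ ⟨σ, mem_aut_of_conj_eq hσ⟩ v, (ht.perm ⟨σ, mem_aut_of_conj_eq hσ⟩ v).symm⟩

lemma range_eq : LinearMap.range (t 1) = orderComponent τ R := by
  refine le_antisymm ?_ fun z hz => ?_
  · rintro _ ⟨v, rfl⟩
    exact ht.mem_orderComponent v
  · rw [← ht.factorsThroughOrders.mem_orderComponent_iff.mp hz]
    exact ht.action_fIdem_mem_range z

/-- The only nonzero components of the induced module are the components at the conjugates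
of `R`. -/
lemma exists_conj_eq {S : OrderRel E} {z : T}
    (hz : ht.factorsThroughOrders.action (fIdem k E S) z ≠ 0) :
    ∃ σ : Equiv.Perm E, OrderRel.conj σ R = S := by
  by_contra! hc
  refine hz (LinearMap.congr_fun (g := 0) (ht.linearMap_ext fun Q v => ?_) z)
  rw [ht.action_apply]
  rcases fIdem_mul_relClass_mul_fIdem k S R Q with h | ⟨σ, hσ, h⟩
  · rw [ht.congr _ 0 v (by rw [mul_assoc, h, zero_mul]), map_zero]
    rfl
  · exact absurd hσ (hc σ)

end IsInduced

end Induced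

/-- An invariant submodule `N` meets the copy `t 1` of `V` in zero or in all of it. All of it
generates `T`; zero is impossible for `N ≠ 0`, since a nonzero component of an element of `N` can be
moved to the component at `R`. -/
theorem IsInduced.isIrreducible {k : Type u} [Field k] {E : FinCorr.{u}} {R : OrderRel E}
    {V : Type u} [AddCommGroup V] [Module k V] {ρ : Representation k R.aut V}
    {T : Type u} [AddCommGroup T] [Module k T] {τ : Representation k (End E) T}
    {t : PermutedOrders k E →ₗ[k] V →ₗ[k] T} (ht : IsInduced ρ τ t)
    (hρ : ρ.IsIrreducible) : τ.IsIrreducible := by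
  rw [Representation.isIrreducible_iff_submodule] at hρ ⊢
  obtain ⟨hV, hρ⟩ := hρ
  refine ⟨ht.injective.nontrivial, fun N hN => ?_⟩
  by_cases hbot : N = ⊥
  · exact Or.inl hbot
  right
  have hN' : ∀ x, ∀ z ∈ N, ht.factorsThroughOrders.action x z ∈ N := by
    intro x z hz
    induction x using PermutedOrders.induction with
    | rel Q => rw [FactorsThroughOrders.action_relClass]; exact hN Q z hz
    | add x y hx hy => rw [map_add]; exact add_mem hx hy
    | smul c x hx => rw [map_smul]; exact N.smul_mem c hx
  have h := hρ (N.comap (t 1)) fun a v hv => by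
    rw [Submodule.mem_comap, ← ht.perm_apply]
    exact hN _ _ hv
  rcases h with h | h
  · exfalso
    obtain ⟨n, hn, hn0⟩ := Submodule.exists_mem_ne_zero_of_ne_bot hbot
    obtain ⟨S, hS⟩ := ht.factorsThroughOrders.exists_action_fIdem_ne_zero hn0
    obtain ⟨σ, rfl⟩ := ht.exists_conj_eq hS
    set w := ht.factorsThroughOrders.action (fIdem k E (OrderRel.conj σ R)) n with hw
    have hwN : w ∈ N := hN' _ _ hn
    -- `Δ_{σ⁻¹}` moves the component at `σR` back to the one at `R`, which is the image of `V`;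
    -- being invertible, it cannot kill `w`.
    have h1 := ht.factorsThroughOrders.perm_mem
      (ht.factorsThroughOrders.action_fIdem_mem (OrderRel.conj σ R) n) σ⁻¹
    rw [← OrderRel.conj_mul, inv_mul_cancel, ← hw, R.conj_eq_self R.aut.one_mem,
      ← ht.range_eq] at h1
    obtain ⟨v, hv⟩ := h1
    have h3 : v ∈ N.comap (t 1) := by
      rw [Submodule.mem_comap, hv]
      exact hN _ _ hwN
    rw [h, Submodule.mem_bot] at h3
    rw [h3, map_zero] at hv
    have h4 : τ (FinCorr.perm σ) (τ (FinCorr.perm σ⁻¹) w) = w := by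
      rw [← Module.End.mul_apply, ← map_mul, ← map_mul, mul_inv_cancel, map_one, map_one,
        Module.End.one_apply]
    exact hS (by rw [← h4, ← hv, map_zero])
  · refine ht.span_rel N fun Q v => ?_
    have h1 : v ∈ N.comap (t 1) := h ▸ Submodule.mem_top
    have h2 := hN Q _ h1
    rwa [ht.apply_rel, mul_one] at h2

/-! ## The modules `T_{R,V}` -/

section TRep

variable {k : Type u} [CommRing k] {E : FinCorr.{u}} (R : OrderRel E) {V : Type u}
  [AddCommGroup V] [Module k V] (ρ : Representation k R.aut V)

open scoped Classical in
/-- The map from the free module on the permutations which applies the automorphisms of `R` to an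
element of `V` and kills the other permutations. -/
def autEval : (Equiv.Perm E →₀ k) →ₗ[k] V →ₗ[k] V :=
  Finsupp.lift (V →ₗ[k] V) k (Equiv.Perm E) fun σ => if h : σ ∈ R.aut then ρ ⟨σ, h⟩ else 0

lemma autEval_mapDomain (b : R.aut) (u : Equiv.Perm E →₀ k) (v : V) :
    autEval R ρ (Finsupp.mapDomain (· * b.1) u) v = autEval R ρ u (ρ b v) := by
  induction u using Finsupp.induction_linear with
  | zero => simp
  | add x y hx hy => simp only [Finsupp.mapDomain_add, map_add, LinearMap.add_apply, hx, hy]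
  | single σ c =>
    simp only [Finsupp.mapDomain_single, autEval, Finsupp.lift_apply, zero_smul,
      Finsupp.sum_single_index, LinearMap.smul_apply]
    by_cases h : σ ∈ R.aut
    · rw [dif_pos h, dif_pos (R.aut.mul_mem h b.2), ← Module.End.mul_apply, ← map_mul]
      rfl
    · rw [dif_neg h, dif_neg (fun h' => h ((R.aut.mul_mem_cancel_right b.2).mp h'))]
      simp

lemma action_mapDomain (x : PermutedOrders k E) (b : R.aut) (u : Equiv.Perm E →₀ k) :
    (factorsThroughOrders_permRep k R).action x (Finsupp.mapDomain (· * b.1) u) =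
      Finsupp.mapDomain (· * b.1) ((factorsThroughOrders_permRep k R).action x u) := by
  induction x using PermutedOrders.induction with
  | rel Q => rw [FactorsThroughOrders.action_relClass, permRep_mul_right]
  | add x y hx hy => simp only [map_add, LinearMap.add_apply, hx, hy, Finsupp.mapDomain_add]
  | smul c x hx => simp only [map_smul, LinearMap.smul_apply, hx, Finsupp.mapDomain_smul]

/-- The map `x ↦ x f_R` from the algebra of permuted orders to the fundamental module. -/
def toFundamental : PermutedOrders k E →ₗ[k] fundamentalModule k R :=
  (LinearMap.mulRight k (fIdem k E R)).rangeRestrict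

lemma toFundamental_surjective : Function.Surjective (toFundamental (k := k) R) :=
  LinearMap.surjective_rangeRestrict _

lemma fundamentalLeft_toFundamental (Q : End E) (x : PermutedOrders k E) :
    fundamentalLeft k R Q (toFundamental R x) = toFundamental R (relClass k E Q * x) :=
  Subtype.ext (mul_assoc _ _ _).symm

lemma fundamentalRight_one (σ : R.aut) :
    fundamentalRight k R (MulOpposite.op σ) (toFundamental R 1) =
      toFundamental R (relClass k E (perm σ.1)) := by
  refine Subtype.ext ?_
  have h := fIdem_conj k E σ.1 R
  rw [R.conj_eq_self σ.2] at h
  change 1 * fIdem k E R * relClass k E (perm σ.1) = relClass k E (perm σ.1) * fIdem k E R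
  rw [one_mul, h]

/-- A retraction of the embedding `V → T_{R,V}`. -/
def tRetraction : BalancedTensor (A := fundamentalModule k R) (fundamentalRight k R) ρ →ₗ[k] V :=
  BalancedTensor.lift
    -- `x ⊗ v` is sent to the value at `v` of the automorphism part of `x · 1`, where `1` is the
    -- basis vector of `permRep` at the identity.
    ((autEval R ρ).comp ((LinearMap.applyₗ (Finsupp.single 1 1)).comp
      ((factorsThroughOrders_permRep k R).action.toLinearMap.comp
        (fundamentalModule k R).subtype))) (by
    intro a b v
    change autEval R ρ ((factorsThroughOrders_permRep k R).action
      (a.1 * relClass k E (perm b.1)) (Finsupp.single 1 1)) v =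
      autEval R ρ ((factorsThroughOrders_permRep k R).action a.1 (Finsupp.single 1 1)) (ρ b v)
    -- `Δ_b` sends the basis vector 1 to `b`, which is also its right translate by `b`; right
    -- translations commute with `x`, and `autEval` turns them into the action of `b` on `V`.
    rw [map_mul, Module.End.mul_apply, FactorsThroughOrders.action_relClass, permRep_perm,
      ← autEval_mapDomain, ← action_mapDomain, Finsupp.mapDomain_single, mul_one, one_mul])


/-- The bilinear map `(x, v) ↦ x f_R ⊗ v` from `𝒫_E × V` to `T_{R,V}`. -/
def tMk := BalancedTensor.mkComp (A := fundamentalModule k R) (fundamentalRight k R) ρ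
    (toFundamental R)

lemma isInduced_tMk : IsInduced ρ (TRep R ρ) (tMk R ρ) := by
  refine ⟨?_, ?_, ?_, ?_, ?_⟩
  · intro Q x v
    exact congrArg (fun y =>
      BalancedTensor.tmul (A := fundamentalModule k R) (fundamentalRight k R) ρ y v)
      (fundamentalLeft_toFundamental R Q x)
  · intro x y v h
    exact congrArg (fun y =>
      BalancedTensor.tmul (A := fundamentalModule k R) (fundamentalRight k R) ρ y v)
      (Subtype.ext h : toFundamental R x = toFundamental R y)
  · intro σ v
    have h := BalancedTensor.mkComp_balanced (A := fundamentalModule k R)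
      (r := fundamentalRight k R) (m := σ) ρ (toFundamental R) (x := 1)
      (y := relClass k E (perm σ.1)) (fundamentalRight_one R σ) v
    rw [tMk]
    exact h
  · intro N hN
    refine eq_top_iff.mpr fun z _ => ?_
    induction z using BalancedTensor.induction with
    | add x y hx hy => exact add_mem (hx trivial) (hy trivial)
    | tmul a v =>
      obtain ⟨x, rfl⟩ := toFundamental_surjective R a
      exact hN x v
  -- `f_R` fixes the basis vector 1 of `permRep`, where `autEval` is the identity of `V`.
  · refine Function.LeftInverse.injective (g := tRetraction R ρ) fun v => ?_
    change autEval R ρ ((factorsThroughOrders_permRep k R).action (1 * fIdem k E R)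
      (Finsupp.single 1 1)) v = v
    rw [one_mul, ((factorsThroughOrders_permRep k R).mem_orderComponent_iff.mp
      (single_one_mem_orderComponent k R 1)), autEval]
    simp only [Finsupp.lift_apply, zero_smul, Finsupp.sum_single_index, one_smul]
    rw [dif_pos R.aut.one_mem]
    exact congrArg (fun f : V →ₗ[k] V => f v) (map_one ρ)

end TRep

/-! ## Irreducible representations of the monoid of relations -/

namespace FinCorr

variable {E : FinCorr.{u}}

lemma rel_mul_perm (S : Set (E × E)) (σ : Equiv.Perm E) :
    rel S * perm σ = perm σ * rel {p : E × E | (σ p.1, σ p.2) ∈ S} := by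
  refine hom_ext fun x z => ?_
  simp only [related_mul, related_rel, related_perm, Set.mem_ofPred_eq]
  constructor
  · rintro ⟨y, h, rfl⟩
    exact ⟨σ.symm x, by simp, by simpa using h⟩
  · rintro ⟨y, rfl, h⟩
    exact ⟨σ z, h, rfl⟩

lemma transClosure_preimage (S : Set (E × E)) (σ : Equiv.Perm E) :
    transClosure {p : E × E | (σ p.1, σ p.2) ∈ S} =
      {p : E × E | (σ p.1, σ p.2) ∈ transClosure S} := by
  ext ⟨x, y⟩
  constructor
  · intro h
    exact Relation.TransGen.lift σ (fun _ _ h => h) x y h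
  · intro h
    have h' : Relation.TransGen (fun a b : E => (σ a, σ b) ∈ S) (σ.symm (σ x)) (σ.symm (σ y)) :=
      Relation.TransGen.lift σ.symm (fun a b hab => by simpa [Function.onFun] using hab) _ _ h
    simp only [Equiv.symm_apply_apply] at h'
    exact h'

/-- As `S` and `T` are reflexive, each is contained in `ST`, so the closure of `ST` contains the
closure of `S` and is stable under composing with `T`. -/
lemma transClosure_mul (S T : Set (E × E)) (hS : ∀ x, (x, x) ∈ S) (hT : ∀ x, (x, x) ∈ T) :
    transClosure {p : E × E | Related (rel (transClosure S) * rel T) p.1 p.2} =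
      transClosure {p : E × E | Related (rel S * rel T) p.1 p.2} := by
  refine Set.Subset.antisymm (transClosure_subset ?_ fun _ _ _ => transClosure_trans _)
    (transClosure_subset ?_ fun _ _ _ => transClosure_trans _)
  · rintro ⟨x, z⟩ ⟨y, h1, h2⟩
    have h3 : transClosure S ⊆ transClosure {p : E × E | Related (rel S * rel T) p.1 p.2} :=
      transClosure_subset (fun ⟨a, b⟩ hab => subset_transClosure _ ⟨b, hab, hT b⟩)
        fun _ _ _ => transClosure_trans _
    exact transClosure_trans _ (h3 h1) (subset_transClosure _ ⟨y, hS y, h2⟩)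
  · rintro ⟨x, z⟩ ⟨y, h1, h2⟩
    exact subset_transClosure _ ⟨y, subset_transClosure _ h1, h2⟩

lemma transClosure_mul_subset (S T : Set (E × E))
    (h : {p : E × E | Related (rel S * rel T) p.1 p.2} ⊆ T) :
    {p : E × E | Related (rel (transClosure S) * rel T) p.1 p.2} ⊆ T := by
  rintro ⟨x, z⟩ ⟨y, h1, h2⟩
  change (y, z) ∈ T at h2
  change Relation.TransGen _ x y at h1
  induction h1 using Relation.TransGen.head_induction_on with
  | single h' => exact h (show (_, z) ∈ _ from ⟨y, h', h2⟩)
  | head h' _ ih => exact h (show (_, z) ∈ _ from ⟨_, h', ih⟩)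

end FinCorr

lemma Representation.map_mul_apply {k G W : Type*} [CommSemiring k] [Monoid G] [AddCommMonoid W]
    [Module k W] (ρ : Representation k G W) (a b : G) (w : W) : ρ (a * b) w = ρ a (ρ b w) := by
  rw [map_mul, Module.End.mul_apply]

section Irreducible

variable {k : Type u} [Field k] {E : FinCorr.{u}} {W : Type u} [AddCommGroup W] [Module k W]
  {ρ : Representation k (End E) W}

/-- The elements on which every reflexive relation acts as its transitive closure. -/
def closureEqLocus (ρ : Representation k (End E) W) : Submodule k W :=
  ⨅ S : {S : Set (E × E) // ∀ x, (x, x) ∈ S},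
    LinearMap.eqLocus (ρ (rel S.1)) (ρ (rel (transClosure S.1)))

lemma mem_closureEqLocus {w : W} : w ∈ closureEqLocus ρ ↔
    ∀ S : Set (E × E), (∀ x, (x, x) ∈ S) → ρ (rel S) w = ρ (rel (transClosure S)) w := by
  simp [closureEqLocus]

/-- By Hall's theorem only reflexive `T` and permutations matter. On `w` the relations `ST` and
`S̄T` act as their closures, which coincide by `transClosure_mul`; a permutation merely conjugates
`S` and its closure. -/
lemma closureEqLocus_invariant (h : ∀ Q, IsInessential Q → ρ Q = 0) (Q : End E) {w : W}
    (hw : w ∈ closureEqLocus ρ) : ρ Q w ∈ closureEqLocus ρ := by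
  rcases isInessential_or_eq_perm_mul Q with hQ | ⟨σ, T, hT, rfl⟩
  · rw [h Q hQ]
    exact zero_mem _
  have h1 : ρ (rel T) w ∈ closureEqLocus ρ := by
    rw [mem_closureEqLocus] at hw ⊢
    intro S hS
    have h1 := hw {p | Related (rel S * rel T) p.1 p.2} fun x => ⟨x, hS x, hT x⟩
    have h2 := hw {p | Related (rel (transClosure S) * rel T) p.1 p.2}
      fun x => ⟨x, subset_transClosure S (hS x), hT x⟩
    rw [← ρ.map_mul_apply, ← ρ.map_mul_apply, eq_rel (rel S * rel T),
      eq_rel (rel (transClosure S) * rel T), h1, h2, transClosure_mul S T hS hT]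
  rw [map_mul, Module.End.mul_apply]
  rw [mem_closureEqLocus] at h1 ⊢
  intro S hS
  rw [← ρ.map_mul_apply (rel S), ← ρ.map_mul_apply (rel (transClosure S)), rel_mul_perm,
    rel_mul_perm, ρ.map_mul_apply,
    ρ.map_mul_apply, ← transClosure_preimage, h1]
  exact fun x => hS _

/-- Take `P` maximal among the reflexive relations with nonzero action and `v` with `Pv ≠ 0`. For
reflexive `S` one has `P ⊆ SP`, so `SPv` is `Pv` if `SP = P` and zero otherwise. The condition `SP ⊆
P` is the same for `S` and its closure, so both act alike on `Pv`. -/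
lemma closureEqLocus_ne_bot [Nontrivial W] : closureEqLocus ρ ≠ ⊥ := by
  obtain ⟨P, hP⟩ := Set.Finite.exists_maximal
    (Set.toFinite {S : Set (E × E) | (∀ x, (x, x) ∈ S) ∧ ρ (rel S) ≠ 0})
    ⟨{p | p.1 = p.2}, fun _ => rfl, by
      change ρ 1 ≠ 0
      rw [map_one]
      exact one_ne_zero⟩
  obtain ⟨⟨hrefl, hP0⟩, hmax⟩ := hP
  obtain ⟨v, hv⟩ : ∃ v, ρ (rel P) v ≠ 0 := by
    by_contra! hc
    exact hP0 (LinearMap.ext hc)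
  refine (Submodule.ne_bot_iff _).mpr ⟨ρ (rel P) v, mem_closureEqLocus.mpr fun S hS => ?_, hv⟩
  have hsub : ∀ S : Set (E × E), (∀ x, (x, x) ∈ S) →
      P ⊆ {p : E × E | Related (rel S * rel P) p.1 p.2} := fun S hS ⟨x, y⟩ h => ⟨x, hS x, h⟩
  have hzero : ∀ S : Set (E × E), (∀ x, (x, x) ∈ S) →
      ¬ {p : E × E | Related (rel S * rel P) p.1 p.2} ⊆ P → ρ (rel S) (ρ (rel P) v) = 0 := by
    intro S hS hnot
    by_contra hne
    refine hnot (hmax ⟨fun x => ⟨x, hS x, hrefl x⟩, fun h0 => hne ?_⟩ (hsub S hS))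
    rw [← Module.End.mul_apply, ← map_mul, eq_rel (rel S * rel P), h0, LinearMap.zero_apply]
  have hfix : ∀ S : Set (E × E), (∀ x, (x, x) ∈ S) →
      {p : E × E | Related (rel S * rel P) p.1 p.2} ⊆ P →
        ρ (rel S) (ρ (rel P) v) = ρ (rel P) v := by
    intro S hS h
    rw [← Module.End.mul_apply, ← map_mul, eq_rel (rel S * rel P), h.antisymm (hsub S hS)]
  have hS' : ∀ x, (x, x) ∈ transClosure S := fun x => subset_transClosure S (hS x)
  by_cases h : {p : E × E | Related (rel S * rel P) p.1 p.2} ⊆ P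
  · rw [hfix S hS h, hfix _ hS' (transClosure_mul_subset S P h)]
  · rw [hzero S hS h, hzero _ hS' fun h' => h ?_]
    rintro ⟨x, z⟩ ⟨y, h1, h2⟩
    exact h' (show (x, z) ∈ _ from ⟨y, subset_transClosure S h1, h2⟩)

/-- An irreducible representation on which the inessential relations act by zero factors through
the algebra of permuted orders. -/
theorem FactorsThroughOrders.of_isIrreducible (hρ : ρ.IsIrreducible)
    (h : ∀ Q, IsInessential Q → ρ Q = 0) : FactorsThroughOrders ρ := by
  rw [Representation.isIrreducible_iff_submodule] at hρ
  obtain ⟨hW, hρ⟩ := hρ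
  have := (hρ (closureEqLocus ρ) fun Q w hw => closureEqLocus_invariant h Q hw).resolve_left
    closureEqLocus_ne_bot
  refine ⟨h, fun S hS => LinearMap.ext fun w => ?_⟩
  exact mem_closureEqLocus.mp (this ▸ Submodule.mem_top : w ∈ closureEqLocus ρ) S hS

namespace FactorsThroughOrders

variable (h : FactorsThroughOrders ρ)
include h

lemma action_fIdem_apply (w : W) {R S : OrderRel E} (hw : w ∈ orderComponent ρ R) (Q : End E) :
    h.action (fIdem k E S) (ρ Q w) = 0 ∨ ∃ σ : Equiv.Perm E, OrderRel.conj σ R = S ∧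
      h.action (fIdem k E S) (ρ Q w) = ρ (perm σ) w := by
  rw [h.action_fIdem_relClass hw]
  rcases fIdem_mul_relClass_mul_fIdem k S R Q with h1 | ⟨σ, hσ, h1⟩
  · left; rw [h1, map_zero, LinearMap.zero_apply]
  · right
    refine ⟨σ, hσ, ?_⟩
    rw [h1, map_mul, Module.End.mul_apply, h.mem_orderComponent_iff.mp hw, h.action_relClass]

/-- The largest invariant submodule which is mapped to `U` by `f_R`. -/
def coinduced (R : OrderRel E) (U : Submodule k W) : Submodule k W :=
  ⨅ Q : End E, U.comap ((h.action (fIdem k E R)).comp (ρ Q))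

lemma mem_coinduced {R : OrderRel E} {U : Submodule k W} {w : W} :
    w ∈ h.coinduced R U ↔ ∀ Q, h.action (fIdem k E R) (ρ Q w) ∈ U := by
  simp [coinduced]

lemma coinduced_invariant (R : OrderRel E) (U : Submodule k W) (Q : End E) (w : W)
    (hw : w ∈ h.coinduced R U) : ρ Q w ∈ h.coinduced R U := by
  rw [mem_coinduced] at hw ⊢
  intro Q'
  rw [← ρ.map_mul_apply]
  exact hw _

lemma action_fIdem_self {R : OrderRel E} {w : W} (hw : w ∈ orderComponent ρ R) :
    h.action (fIdem k E R) (ρ 1 w) = w := by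
  rw [map_one, Module.End.one_apply, h.mem_orderComponent_iff.mp hw]

/-- The orders with a nonzero component in an irreducible representation are conjugate. -/
lemma exists_conj_eq_of_isIrreducible (hρ : ρ.IsIrreducible) {R S : OrderRel E}
    (hR : orderComponent ρ R ≠ ⊥) (hS : orderComponent ρ S ≠ ⊥) :
    ∃ σ : Equiv.Perm E, OrderRel.conj σ R = S := by
  rw [Representation.isIrreducible_iff_submodule] at hρ
  obtain ⟨w, hw, hw0⟩ := Submodule.exists_mem_ne_zero_of_ne_bot hR
  obtain ⟨v, hv, hv0⟩ := Submodule.exists_mem_ne_zero_of_ne_bot hS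
  by_contra! hc
  -- Without a conjugating permutation, `f_S Q w = 0` for every `Q`. The vectors with this property
  -- form an invariant submodule containing `w` but not `v`.
  have hwmem : w ∈ h.coinduced S ⊥ := by
    rw [mem_coinduced]
    intro Q
    rcases h.action_fIdem_apply w hw (S := S) Q with h1 | ⟨σ, hσ, -⟩
    · exact h1
    · exact absurd hσ (hc σ)
  rcases hρ.2 (h.coinduced S ⊥) (h.coinduced_invariant S ⊥) with h1 | h1
  · exact hw0 (by simpa [h1] using hwmem)
  · have h2 : v ∈ h.coinduced S ⊥ := h1 ▸ Submodule.mem_top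
    have h3 := h.mem_coinduced.mp h2 1
    rw [h.action_fIdem_self hv] at h3
    exact hv0 h3

/-- The representation of `Aut(E,R)` on the component at `R`. -/
def componentRep (R : OrderRel E) : Representation k R.aut (orderComponent ρ R) where
  toFun a := (ρ (perm a.1)).restrict fun w hw => by
    have := h.perm_mem hw a.1
    rwa [R.conj_eq_self a.2] at this
  map_one' := by
    ext w
    change ρ (perm 1) w.1 = w.1
    rw [map_one, map_one, Module.End.one_apply]
  map_mul' a b := by
    ext w
    change ρ (perm (a.1 * b.1)) w.1 = ρ (perm a.1) (ρ (perm b.1) w.1)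
    rw [map_mul, map_mul, Module.End.mul_apply]

/-- Let `N` be the largest invariant submodule sent into `U` by `f_R`. It contains `U`, as `f_R Q u`
is zero or `σu` with `σ` an automorphism. So `N = 0` forces `U = 0`, and `N = W` forces `U` to be
the whole component. -/
lemma isIrreducible_componentRep (hρ : ρ.IsIrreducible) {R : OrderRel E}
    (hR : orderComponent ρ R ≠ ⊥) : (h.componentRep R).IsIrreducible := by
  rw [Representation.isIrreducible_iff_submodule] at hρ ⊢
  refine ⟨(Submodule.nontrivial_iff_ne_bot).mpr hR, fun U hU => ?_⟩
  rcases hρ.2 (h.coinduced R (U.map (orderComponent ρ R).subtype))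
    (h.coinduced_invariant R _) with h1 | h1
  · left
    refine (Submodule.eq_bot_iff _).mpr fun u hu => ?_
    have h2 : u.1 ∈ h.coinduced R (U.map (orderComponent ρ R).subtype) := by
      rw [mem_coinduced]
      intro Q
      rcases h.action_fIdem_apply u.1 u.2 (S := R) Q with h2 | ⟨σ, hσ, h2⟩
      · rw [h2]; exact zero_mem _
      · rw [h2]
        exact ⟨_, hU ⟨σ, mem_aut_of_conj_eq hσ⟩ u hu, rfl⟩
    rw [h1, Submodule.mem_bot] at h2
    exact Subtype.ext h2
  · right
    refine eq_top_iff.mpr fun u _ => ?_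
    have h2 : u.1 ∈ h.coinduced R (U.map (orderComponent ρ R).subtype) := h1 ▸ Submodule.mem_top
    have h3 := h.mem_coinduced.mp h2 1
    rw [h.action_fIdem_self u.2] at h3
    obtain ⟨u', hu', h4⟩ := h3
    exact (Subtype.ext h4 : u' = u) ▸ hu'

end FactorsThroughOrders

end Irreducible

/-! ## Functors on the category of correspondences -/

section Functors

variable {k : Type u} [Field k]

/-- A functor from correspondences to `k`-modules is simple if it is nonzero and has no proper
nonzero subfunctor. -/
def IsSimpleFunctor (P : FinCorr.{u} ⥤ ModuleCat.{u} k) : Prop :=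
  (∃ X, Nontrivial (P.obj X)) ∧ ∀ N : ∀ X, Submodule k (P.obj X),
    (∀ {X Y : FinCorr.{u}} (α : X ⟶ Y) (m : P.obj X), m ∈ N X → (P.map α).hom m ∈ N Y) →
      (∀ X, N X = ⊥) ∨ (∀ X, N X = ⊤)

variable (P P' : FinCorr.{u} ⥤ ModuleCat.{u} k)

lemma map_comp_hom_apply {X Y Z : FinCorr.{u}} (α : X ⟶ Y) (β : Y ⟶ Z) (m : P.obj X) :
    (P.map (α ≫ β)).hom m = (P.map β).hom ((P.map α).hom m) := by
  rw [P.map_comp]; rfl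

/-- The action of the monoid of relations on `E` on the evaluation at `E` of a functor. -/
def evalRep (E : FinCorr.{u}) : Representation k (End E) (P.obj E) where
  toFun Q := (P.map (Q : E ⟶ E)).hom
  map_one' := by
    change (P.map (𝟙 E)).hom = LinearMap.id
    rw [P.map_id]; rfl
  map_mul' Q Q' := by
    change (P.map ((Q' : E ⟶ E) ≫ Q)).hom = _
    rw [P.map_comp]; rfl

lemma evalRep_apply (E : FinCorr.{u}) (Q : End E) (m : P.obj E) :
    evalRep P E Q m = (P.map (Q : E ⟶ E)).hom m := rfl

variable {P}

/-- An invariant `N ⊆ P(E)` is the value at `E` of the subfunctor of all `m` with `ψm ∈ N` for every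
`ψ : X ⟶ E`. -/
lemma IsSimpleFunctor.isIrreducible_evalRep (hP : IsSimpleFunctor P) (E : FinCorr.{u})
    [hE : Nontrivial (P.obj E)] : (evalRep P E).IsIrreducible := by
  rw [Representation.isIrreducible_iff_submodule]
  refine ⟨hE, fun N hN => ?_⟩
  have hN' : (⨅ ψ : E ⟶ E, N.comap (P.map ψ).hom) = N := by
    refine le_antisymm ?_ ?_
    · intro m hm
      have := (Submodule.mem_iInf _).mp hm (𝟙 E)
      rw [Submodule.mem_comap, P.map_id] at this
      exact this
    · intro m hm
      exact (Submodule.mem_iInf _).mpr fun ψ => hN ψ m hm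
  rcases hP.2 (fun X => ⨅ ψ : X ⟶ E, N.comap (P.map ψ).hom) (by
    intro X Y α m hm
    simp only [Submodule.mem_iInf, Submodule.mem_comap] at hm ⊢
    intro ψ
    rw [← map_comp_hom_apply]
    exact hm _) with h | h
  · exact Or.inl (hN'.symm.trans (h E))
  · exact Or.inr (hN'.symm.trans (h E))

variable (P) in
/-- The functor vanishes on the sets which are smaller than `E`. -/
def VanishesBelow (E : FinCorr.{u}) : Prop :=
  ∀ Y : FinCorr.{u}, Nat.card Y < Nat.card E → Subsingleton (P.obj Y)

lemma VanishesBelow.evalRep_eq_zero {E : FinCorr.{u}} (h : VanishesBelow P E) (Q : End E)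
    (hQ : IsInessential Q) : evalRep P E Q = 0 := by
  obtain ⟨Y, A, B, hY, rfl⟩ := hQ
  have := h Y hY
  refine LinearMap.ext fun m => ?_
  rw [evalRep_apply, map_comp_hom_apply, Subsingleton.elim ((P.map A).hom m) 0, map_zero]
  rfl

lemma IsSimpleFunctor.factorsThroughOrders (hP : IsSimpleFunctor P) {E : FinCorr.{u}}
    (h : VanishesBelow P E) [Nontrivial (P.obj E)] : FactorsThroughOrders (evalRep P E) :=
  .of_isIrreducible (hP.isIrreducible_evalRep E) h.evalRep_eq_zero

variable (P) in
/-- The functor `P` vanishes below `E` and the component of `P(E)` at `R` is isomorphic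
to `V`. -/
structure HasType (t : PosetTriple k) : Prop where
  vanishesBelow : VanishesBelow P t.E
  exists_map : ∃ θ : t.V →ₗ[k] P.obj t.E, Function.Injective θ ∧
    LinearMap.range θ = orderComponent (evalRep P t.E) t.R ∧
      ∀ (a : t.R.aut) v, evalRep P t.E (perm a.1) (θ v) = θ (t.ρ a v)

lemma PosetTriple.nontrivial (t : PosetTriple k) : Nontrivial t.V :=
  ((Representation.isIrreducible_iff_submodule _).mp t.simple).1

lemma HasType.nontrivial {t : PosetTriple k} (h : HasType P t) : Nontrivial (P.obj t.E) := by
  obtain ⟨θ, hθ, -⟩ := h.exists_map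
  have := t.nontrivial
  exact hθ.nontrivial

lemma HasType.orderComponent_ne_bot {t : PosetTriple k} (h : HasType P t) :
    orderComponent (evalRep P t.E) t.R ≠ ⊥ := by
  obtain ⟨θ, hθ, hr, -⟩ := h.exists_map
  have := t.nontrivial
  rw [← hr]
  intro h0
  obtain ⟨v, hv⟩ := exists_ne (0 : t.V)
  have h1 : θ v ∈ LinearMap.range θ := ⟨v, rfl⟩
  rw [h0, Submodule.mem_bot] at h1
  exact hv (hθ (h1.trans (map_zero θ).symm))

/-! ### Uniqueness of the simple functor of a given type -/

section Uniqueness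

variable {P'} {E : FinCorr.{u}} {R : OrderRel E} {V : Type u} [AddCommGroup V] [Module k V]

/-- The pairs which have the same images in `V`. -/
def linkingRelation (h : FactorsThroughOrders (evalRep P E))
    (h' : FactorsThroughOrders (evalRep P' E)) (R : OrderRel E) (θ : V →ₗ[k] P.obj E)
    (θ' : V →ₗ[k] P'.obj E) (X : FinCorr.{u}) : Submodule k (P.obj X × P'.obj X) :=
  ⨅ ψ : X ⟶ E, (LinearMap.range (θ.prod θ')).comap
    (((h.action (fIdem k E R)).comp (P.map ψ).hom).prodMap
      ((h'.action (fIdem k E R)).comp (P'.map ψ).hom))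

variable {h : FactorsThroughOrders (evalRep P E)} {h' : FactorsThroughOrders (evalRep P' E)}
  {θ : V →ₗ[k] P.obj E} {θ' : V →ₗ[k] P'.obj E}

lemma mem_linkingRelation {X : FinCorr.{u}} {x : P.obj X} {x' : P'.obj X} :
    (x, x') ∈ linkingRelation h h' R θ θ' X ↔ ∀ ψ : X ⟶ E, ∃ v,
      θ v = h.action (fIdem k E R) ((P.map ψ).hom x) ∧
        θ' v = h'.action (fIdem k E R) ((P'.map ψ).hom x') := by
  simp [linkingRelation]

lemma mem_linkingRelation_swap {X : FinCorr.{u}} {x : P.obj X} {x' : P'.obj X} :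
    (x', x) ∈ linkingRelation h' h R θ' θ X ↔ (x, x') ∈ linkingRelation h h' R θ θ' X := by
  simp only [mem_linkingRelation, and_comm]

lemma map_mem_linkingRelation {X Y : FinCorr.{u}} (α : X ⟶ Y) {x : P.obj X} {x' : P'.obj X}
    (hx : (x, x') ∈ linkingRelation h h' R θ θ' X) :
    ((P.map α).hom x, (P'.map α).hom x') ∈ linkingRelation h h' R θ θ' Y := by
  rw [mem_linkingRelation] at hx ⊢
  intro ψ
  rw [← map_comp_hom_apply, ← map_comp_hom_apply]
  exact hx _

/-- The `x` linked to 0 form a subfunctor of `P`. If it were all of `P`, some `θ v` with `v ≠ 0`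
would be linked to 0, and testing with the identity of `E` gives a contradiction. -/
lemma eq_zero_of_mem_linkingRelation [Nontrivial V] (hP : IsSimpleFunctor P)
    (hθ : Function.Injective θ) (hθ' : Function.Injective θ')
    (hr : LinearMap.range θ = orderComponent (evalRep P E) R) {X : FinCorr.{u}} {x : P.obj X}
    (hx : (x, 0) ∈ linkingRelation h h' R θ θ' X) : x = 0 := by
  rcases hP.2 (fun X => (linkingRelation h h' R θ θ' X).comap (LinearMap.inl k _ _)) (by
    intro X Y α m hm
    have hm' : (m, (0 : P'.obj X)) ∈ linkingRelation h h' R θ θ' X := hm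
    have := map_mem_linkingRelation α hm'
    rwa [map_zero] at this) with h1 | h1
  · have h2 : x ∈ (linkingRelation h h' R θ θ' X).comap (LinearMap.inl k _ _) := hx
    rw [h1] at h2
    exact h2
  · exfalso
    obtain ⟨v, hv⟩ := exists_ne (0 : V)
    have h2 : θ v ∈ (linkingRelation h h' R θ θ' E).comap (LinearMap.inl k _ _) :=
      (h1 E) ▸ Submodule.mem_top
    have h2 : (θ v, (0 : P'.obj E)) ∈ linkingRelation h h' R θ θ' E := h2
    obtain ⟨w, hw, hw'⟩ := mem_linkingRelation.mp h2 (𝟙 E)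
    have h3 : h.action (fIdem k E R) ((P.map (𝟙 E)).hom (θ v)) = θ v :=
      h.action_fIdem_self (hr ▸ ⟨v, rfl⟩)
    rw [h3] at hw
    rw [map_zero, map_zero] at hw'
    rw [← hθ hw] at hv
    exact hv (hθ' (hw'.trans (map_zero θ').symm))

/-- The product `f_R Q f_R` is computed in `𝒫_E`, so the same alternative (zero, or an automorphism
`σ`) holds in both functors, and `θ`, `θ'` are both equivariant. -/
lemma map_mem_linkingRelation_self {ρ : Representation k R.aut V}
    (hr : LinearMap.range θ = orderComponent (evalRep P E) R)
    (hr' : LinearMap.range θ' = orderComponent (evalRep P' E) R)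
    (he : ∀ (a : R.aut) v, evalRep P E (perm a.1) (θ v) = θ (ρ a v))
    (he' : ∀ (a : R.aut) v, evalRep P' E (perm a.1) (θ' v) = θ' (ρ a v)) (v : V) :
    (θ v, θ' v) ∈ linkingRelation h h' R θ θ' E := by
  rw [mem_linkingRelation]
  intro Q
  have hv : θ v ∈ orderComponent (evalRep P E) R := hr ▸ ⟨v, rfl⟩
  have hv' : θ' v ∈ orderComponent (evalRep P' E) R := hr' ▸ ⟨v, rfl⟩
  have h1 := h.action_fIdem_relClass hv (S := R) Q
  have h1' := h'.action_fIdem_relClass hv' (S := R) Q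
  rw [evalRep_apply] at h1 h1'
  rw [h1, h1']
  rcases fIdem_mul_relClass_mul_fIdem k R R Q with h2 | ⟨σ, hσ, h2⟩
  · exact ⟨0, by simp [h2]⟩
  · refine ⟨ρ ⟨σ, mem_aut_of_conj_eq hσ⟩ v, ?_, ?_⟩
    · rw [h2, map_mul, Module.End.mul_apply, h.mem_orderComponent_iff.mp hv, h.action_relClass]
      exact (he ⟨σ, mem_aut_of_conj_eq hσ⟩ v).symm
    · rw [h2, map_mul, Module.End.mul_apply, h'.mem_orderComponent_iff.mp hv', h'.action_relClass]
      exact (he' ⟨σ, mem_aut_of_conj_eq hσ⟩ v).symm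

/-- The first projection of the linking relation is a subfunctor of `P`, nonzero because it contains
the `θ v`. -/
lemma exists_mem_linkingRelation [Nontrivial V] (hP : IsSimpleFunctor P)
    (hθ : Function.Injective θ)
    (hmem : ∀ v, (θ v, θ' v) ∈ linkingRelation h h' R θ θ' E) {X : FinCorr.{u}} (x : P.obj X) :
    ∃ x', (x, x') ∈ linkingRelation h h' R θ θ' X := by
  rcases hP.2 (fun X => (linkingRelation h h' R θ θ' X).map (LinearMap.fst k _ _)) (by
    rintro X Y α m ⟨⟨x, x'⟩, hx, rfl⟩
    exact ⟨_, map_mem_linkingRelation α hx, rfl⟩) with h1 | h1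
  · exfalso
    obtain ⟨v, hv⟩ := exists_ne (0 : V)
    have h2 : θ v ∈ (linkingRelation h h' R θ θ' E).map (LinearMap.fst k _ _) :=
      ⟨_, hmem v, rfl⟩
    rw [h1, Submodule.mem_bot] at h2
    exact hv (hθ (h2.trans (map_zero θ).symm))
  · have h2 : x ∈ (linkingRelation h h' R θ θ' X).map (LinearMap.fst k _ _) :=
      (h1 X) ▸ Submodule.mem_top
    obtain ⟨⟨y, x'⟩, hx, rfl⟩ := h2
    exact ⟨x', hx⟩

end Uniqueness

/-- A linear relation which is bijective is the graph of a linear equivalence. -/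
lemma exists_linearEquiv_of_relation {A B : Type u} [AddCommGroup A] [Module k A] [AddCommGroup B]
    [Module k B] (N : Submodule k (A × B)) (h1 : ∀ a, ∃ b, (a, b) ∈ N) (h2 : ∀ b, ∃ a, (a, b) ∈ N)
    (h3 : ∀ a, (a, 0) ∈ N → a = 0) (h4 : ∀ b, (0, b) ∈ N → b = 0) :
    ∃ e : A ≃ₗ[k] B, ∀ a, (a, e a) ∈ N := by
  let f : N →ₗ[k] A := (LinearMap.fst k A B).comp N.subtype
  let g : N →ₗ[k] B := (LinearMap.snd k A B).comp N.subtype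
  have hf : Function.Bijective f := by
    refine ⟨(injective_iff_map_eq_zero f).mpr ?_, fun a => ?_⟩
    · rintro ⟨⟨a, b⟩, hab⟩ (rfl : a = 0)
      exact Subtype.ext (Prod.ext rfl (h4 b hab))
    · obtain ⟨b, hb⟩ := h1 a
      exact ⟨⟨_, hb⟩, rfl⟩
  have hg : Function.Bijective g := by
    refine ⟨(injective_iff_map_eq_zero g).mpr ?_, fun b => ?_⟩
    · rintro ⟨⟨a, b⟩, hab⟩ (rfl : b = 0)
      exact Subtype.ext (Prod.ext (h3 a hab) rfl)
    · obtain ⟨a, ha⟩ := h2 b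
      exact ⟨⟨_, ha⟩, rfl⟩
  refine ⟨(LinearEquiv.ofBijective f hf).symm.trans (LinearEquiv.ofBijective g hg), fun a => ?_⟩
  obtain ⟨n, rfl⟩ := (LinearEquiv.ofBijective f hf).surjective a
  rw [LinearEquiv.trans_apply, LinearEquiv.symm_apply_apply]
  exact n.2

/-- Two simple functors of the same type are isomorphic. -/
theorem HasType.nonempty_iso {P' : FinCorr.{u} ⥤ ModuleCat.{u} k} (hP : IsSimpleFunctor P)
    (hP' : IsSimpleFunctor P') {t : PosetTriple k} (ht : HasType P t) (ht' : HasType P' t) :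
    Nonempty (P ≅ P') := by
  have := t.nontrivial
  have := ht.nontrivial
  have := ht'.nontrivial
  have h := hP.factorsThroughOrders ht.vanishesBelow
  have h' := hP'.factorsThroughOrders ht'.vanishesBelow
  obtain ⟨θ, hθ, hr, he⟩ := ht.exists_map
  obtain ⟨θ', hθ', hr', he'⟩ := ht'.exists_map
  have hmem : ∀ v, (θ v, θ' v) ∈ linkingRelation h h' t.R θ θ' t.E :=
    map_mem_linkingRelation_self hr hr' he he'
  have h4 : ∀ X x', (0, x') ∈ linkingRelation h h' t.R θ θ' X → x' = 0 := fun X x' hx =>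
    eq_zero_of_mem_linkingRelation hP' hθ' hθ hr' (mem_linkingRelation_swap.mpr hx)
  have hex : ∀ X, ∃ e : P.obj X ≃ₗ[k] P'.obj X,
      ∀ x, (x, e x) ∈ linkingRelation h h' t.R θ θ' X := by
    intro X
    refine exists_linearEquiv_of_relation _ (exists_mem_linkingRelation hP hθ hmem) ?_
      (fun x => eq_zero_of_mem_linkingRelation hP hθ hθ' hr) (h4 X)
    intro x'
    obtain ⟨x, hx⟩ := exists_mem_linkingRelation (h := h') (h' := h) (θ := θ') (θ' := θ) hP' hθ'
      (fun v => mem_linkingRelation_swap.mpr (hmem v)) x'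
    exact ⟨x, mem_linkingRelation_swap.mp hx⟩
  choose e he using hex
  refine ⟨NatIso.ofComponents (fun X => (e X).toModuleIso) fun {X Y} α => ?_⟩
  ext x
  change e Y ((P.map α).hom x) = (P'.map α).hom (e X x)
  -- Both elements of `P'(Y)` are linked to the same element of `P(Y)`, so their difference is
  -- linked to 0.
  have h5 := sub_mem (he Y ((P.map α).hom x)) (map_mem_linkingRelation α (he X x))
  rw [Prod.mk_sub_mk, sub_self] at h5
  exact sub_eq_zero.mp (h4 Y _ h5)

end Functors

/-! ### Transport along bijections -/

namespace FinCorr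

variable {X Y Z : FinCorr.{u}}

/-- The graph of a map. -/
def graph (e : X → Y) : X ⟶ Y := ofRel fun y x => y = e x

lemma graph_comp (e : X → Y) (f : Y → Z) : graph e ≫ graph f = graph (f ∘ e) := by
  refine hom_ext fun z x => ?_
  simp [graph]

lemma graph_id : graph (id : X → X) = 𝟙 X := rfl

lemma graph_perm (σ : Equiv.Perm X) : (perm σ : End X) = graph σ := rfl

/-- The inverse image of an order by a bijection. -/
def pullback (e : X ≃ Y) (S : OrderRel Y) : OrderRel X :=
  ⟨{p | (e p.1, e p.2) ∈ S.1},
    ⟨fun _ => S.2.refl _, fun _ _ h h' => e.injective (S.2.antisymm _ _ h h'),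
      fun _ _ _ h h' => S.2.trans _ _ _ h h'⟩⟩

lemma mem_pullback (e : X ≃ Y) (S : OrderRel Y) (x y : X) :
    (x, y) ∈ (pullback e S).1 ↔ (e x, e y) ∈ S.1 := Iff.rfl

lemma pullback_le_pullback (e : X ≃ Y) {S T : OrderRel Y} :
    pullback e S ≤ pullback e T ↔ S ≤ T := by
  constructor
  · rintro h ⟨x, y⟩ hxy
    have := @h (e.symm x, e.symm y) (by simpa [mem_pullback] using hxy)
    simpa [mem_pullback] using this
  · rintro h ⟨x, y⟩ hxy
    exact h hxy

lemma pullback_comp_graph (e : X ≃ Y) (S : OrderRel Y) :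
    (rel (pullback e S).1 : X ⟶ X) ≫ graph e = graph e ≫ (rel S.1 : Y ⟶ Y) := by
  refine hom_ext fun y x => ?_
  simp only [related_comp, related_rel, mem_pullback, graph, related_ofRel]
  constructor
  · rintro ⟨z, rfl, h⟩
    exact ⟨e x, h, rfl⟩
  · rintro ⟨z, h, rfl⟩
    exact ⟨e.symm y, by simp, by simpa using h⟩

lemma eq_pullback_of_mem_iff {e : X ≃ Y} {R : OrderRel X} {S : OrderRel Y}
    (h : ∀ x y, (e x, e y) ∈ S.1 ↔ (x, y) ∈ R.1) : R = pullback e S :=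
  OrderRel.ext (Set.ext fun p => (h p.1 p.2).symm)

end FinCorr

section Transport

variable {k : Type u} [Field k] {P : FinCorr.{u} ⥤ ModuleCat.{u} k}

lemma map_graph_symm {X Y : FinCorr.{u}} (e : X ≃ Y) (m : P.obj X) :
    (P.map (graph e.symm)).hom ((P.map (graph e)).hom m) = m := by
  rw [← map_comp_hom_apply, graph_comp, e.symm_comp_self, graph_id, P.map_id]
  rfl

lemma map_graph_mem_orderComponent {X Y : FinCorr.{u}} (e : X ≃ Y) {S : OrderRel Y} {m : P.obj X}
    (hm : m ∈ orderComponent (evalRep P X) (pullback e S)) :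
    (P.map (graph e)).hom m ∈ orderComponent (evalRep P Y) S := by
  refine mem_orderComponent.mpr fun T => ?_
  have h : evalRep P Y (rel T.1) ((P.map (graph e)).hom m) =
      (P.map (graph e)).hom (evalRep P X (rel (pullback e T).1) m) := by
    rw [evalRep_apply, evalRep_apply, ← map_comp_hom_apply, ← map_comp_hom_apply,
      pullback_comp_graph]
  rw [h]
  refine ⟨fun hT => ?_, fun hT => ?_⟩
  · rw [(mem_orderComponent.mp hm _).1 ((pullback_le_pullback e).mpr hT)]
  · rw [(mem_orderComponent.mp hm _).2 fun h' => hT ((pullback_le_pullback e).mp h'), map_zero]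

lemma map_graph_range {X Y : FinCorr.{u}} (e : X ≃ Y) {R : OrderRel X} {S : OrderRel Y}
    (h : ∀ x y, (e x, e y) ∈ S.1 ↔ (x, y) ∈ R.1) {V : Type u} [AddCommGroup V] [Module k V]
    {θ : V →ₗ[k] P.obj X} (hθ : LinearMap.range θ = orderComponent (evalRep P X) R) :
    LinearMap.range ((P.map (graph e)).hom.comp θ) = orderComponent (evalRep P Y) S := by
  refine le_antisymm ?_ fun m hm => ?_
  · rintro _ ⟨v, rfl⟩
    refine map_graph_mem_orderComponent e ?_
    rw [← eq_pullback_of_mem_iff h, ← hθ]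
    exact ⟨v, rfl⟩
  · have h1 : S = pullback e.symm R := eq_pullback_of_mem_iff fun x y => by
      rw [← h, e.apply_symm_apply, e.apply_symm_apply]
    rw [h1] at hm
    have h2 := map_graph_mem_orderComponent e.symm hm
    rw [← hθ] at h2
    obtain ⟨v, hv⟩ := h2
    refine ⟨v, ?_⟩
    rw [LinearMap.comp_apply, hv]
    exact map_graph_symm e.symm m

lemma map_graph_injective {X Y : FinCorr.{u}} (e : X ≃ Y) :
    Function.Injective (P.map (graph e)).hom :=
  Function.LeftInverse.injective (map_graph_symm e)

lemma map_graph_evalRep_perm {X Y : FinCorr.{u}} (e : X ≃ Y) (a : Equiv.Perm X)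
    (a' : Equiv.Perm Y) (h : ∀ x, a' (e x) = e (a x)) (m : P.obj X) :
    (P.map (graph e)).hom (evalRep P X (perm a) m) =
      evalRep P Y (perm a') ((P.map (graph e)).hom m) := by
  rw [evalRep_apply, evalRep_apply, ← map_comp_hom_apply, ← map_comp_hom_apply, graph_perm,
    graph_perm, graph_comp, graph_comp]
  exact congrArg (fun g : X → Y => (P.map (graph g)).hom m) (funext fun x => (h x).symm)

/-- The type of a functor can be transported along an isomorphism of triples. -/
theorem HasType.of_isIso {t t' : PosetTriple k} (ht : HasType P t)
    (h : PosetTriple.IsIso t t') : HasType P t' := by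
  obtain ⟨e, he, f, hf⟩ := h
  obtain ⟨θ, hθ, hr, hequiv⟩ := ht.exists_map
  refine ⟨fun Y hY => ht.vanishesBelow Y (by rwa [Nat.card_congr e]),
    ((P.map (graph e)).hom.comp θ).comp f.symm.toLinearMap, ?_, ?_, ?_⟩
  · exact ((map_graph_injective e).comp hθ).comp f.symm.injective
  · rw [LinearMap.range_comp_of_range_eq_top _ f.symm.range]
    exact map_graph_range e he hr
  · intro a' v
    let a : t.R.aut := ⟨(e.trans a'.1).trans e.symm, fun x y => by
      simp only [Equiv.trans_apply]
      rw [← he, e.apply_symm_apply, e.apply_symm_apply, a'.2, he]⟩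
    have ha : ∀ x, a'.1 (e x) = e (a.1 x) := fun x => by simp [a]
    obtain ⟨w, rfl⟩ := f.surjective v
    change evalRep P t'.E (perm a'.1) ((P.map (graph e)).hom (θ (f.symm (f w)))) =
      (P.map (graph e)).hom (θ (f.symm (t'.ρ a' (f w))))
    rw [← hf a a' ha, f.symm_apply_apply, f.symm_apply_apply, ← hequiv,
      map_graph_evalRep_perm e a.1 a'.1 ha]

lemma exists_linearEquiv_of_range_eq {A B C : Type u} [AddCommGroup A] [Module k A]
    [AddCommGroup B] [Module k B] [AddCommGroup C] [Module k C] {f : A →ₗ[k] C} {g : B →ₗ[k] C}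
    (hf : Function.Injective f) (hg : Function.Injective g)
    (h : LinearMap.range f = LinearMap.range g) : ∃ e : A ≃ₗ[k] B, ∀ a, g (e a) = f a := by
  refine ⟨(LinearEquiv.ofInjective f hf).trans ((LinearEquiv.ofEq _ _ h).trans
    (LinearEquiv.ofInjective g hg).symm), fun a => ?_⟩
  have := congrArg Subtype.val ((LinearEquiv.ofInjective g hg).apply_symm_apply
    ((LinearEquiv.ofEq _ _ h) (LinearEquiv.ofInjective f hf a)))
  exact this

lemma HasType.card_le {t t' : PosetTriple k} (ht : HasType P t) (ht' : HasType P t') :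
    Nat.card t.E ≤ Nat.card t'.E := by
  by_contra! h
  have := ht'.nontrivial
  exact not_subsingleton _ (ht.vanishesBelow _ h)

/-- The type of a simple functor is unique up to isomorphism. -/
theorem HasType.isIso (hP : IsSimpleFunctor P) {t t' : PosetTriple k} (ht : HasType P t)
    (ht' : HasType P t') : PosetTriple.IsIso t t' := by
  have := ht'.nontrivial
  -- Both sets have the least cardinality at which `P` is nonzero. The bijection `e₀` need not
  -- respect the orders.
  obtain ⟨e₀⟩ : Nonempty (t.E ≃ t'.E) :=
    Finite.card_eq.mp ((ht.card_le ht').antisymm (ht'.card_le ht))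
  have h := hP.factorsThroughOrders ht'.vanishesBelow
  have he₀ : t.R = pullback e₀ (pullback e₀.symm t.R) := OrderRel.ext (Set.ext fun p => by
    simp [pullback])
  obtain ⟨θ, hθ, hr, hequiv⟩ := ht.exists_map
  obtain ⟨θ', hθ', hr', hequiv'⟩ := ht'.exists_map
  have hne : orderComponent (evalRep P t'.E) (pullback e₀.symm t.R) ≠ ⊥ := by
    obtain ⟨m, hm, hm0⟩ := Submodule.exists_mem_ne_zero_of_ne_bot ht.orderComponent_ne_bot
    rw [he₀] at hm
    exact (Submodule.ne_bot_iff _).mpr ⟨_, map_graph_mem_orderComponent e₀ hm, fun h0 =>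
      hm0 (map_graph_injective e₀ (h0.trans (map_zero _).symm))⟩
  -- The order carried over by `e₀` and `t'.R` both have nonzero components in the irreducible
  -- module `P(t'.E)`, hence are conjugate; `σ` corrects `e₀` to a poset isomorphism.
  obtain ⟨σ, hσ⟩ := h.exists_conj_eq_of_isIrreducible (hP.isIrreducible_evalRep t'.E) hne
    ht'.orderComponent_ne_bot
  let e : t.E ≃ t'.E := e₀.trans σ
  have he : ∀ x y, (e x, e y) ∈ t'.R.1 ↔ (x, y) ∈ t.R.1 := by
    intro x y
    rw [← hσ]
    change (e₀.symm (σ.symm (σ (e₀ x))), e₀.symm (σ.symm (σ (e₀ y)))) ∈ t.R.1 ↔ _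
    simp
  -- The transported embedding of `V` and the embedding of `V'` have the same image, the component
  -- at `t'.R`.
  obtain ⟨f, hf⟩ := exists_linearEquiv_of_range_eq
    (f := (P.map (graph e)).hom.comp θ) (g := θ') ((map_graph_injective e).comp hθ) hθ'
    ((map_graph_range e he hr).trans hr'.symm)
  refine ⟨e, he, f, fun a a' ha v => hθ' ?_⟩
  rw [hf, LinearMap.comp_apply, ← hequiv, map_graph_evalRep_perm e a.1 a'.1 ha, ← hequiv', hf]
  rfl

/-- Every simple functor has a type. -/
theorem IsSimpleFunctor.exists_hasType (hP : IsSimpleFunctor P) :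
    ∃ t : PosetTriple k, HasType P t := by
  obtain ⟨E, hE, hmin⟩ : ∃ E : FinCorr.{u}, Nontrivial (P.obj E) ∧ VanishesBelow P E := by
    have hex : ∃ n, ∃ X : FinCorr.{u}, Nat.card X = n ∧ Nontrivial (P.obj X) := by
      obtain ⟨X, hX⟩ := hP.1
      exact ⟨_, X, rfl, hX⟩
    classical
    obtain ⟨E, hE, hE'⟩ := Nat.find_spec hex
    refine ⟨E, hE', fun Y hY => ?_⟩
    by_contra hns
    rw [not_subsingleton_iff_nontrivial] at hns
    rw [hE] at hY
    exact Nat.find_min hex hY ⟨Y, rfl, hns⟩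
  have h := hP.factorsThroughOrders hmin
  obtain ⟨m, hm⟩ := exists_ne (0 : P.obj E)
  -- The `f_R` sum to 1, so one of them does not kill `m`; its component serves as `V`.
  obtain ⟨R, hR⟩ := h.exists_action_fIdem_ne_zero hm
  have hne : orderComponent (evalRep P E) R ≠ ⊥ :=
    (Submodule.ne_bot_iff _).mpr ⟨_, h.action_fIdem_mem R m, hR⟩
  refine ⟨{ E := E, R := R, V := orderComponent (evalRep P E) R, ρ := h.componentRep R,
            simple := h.isIrreducible_componentRep (hP.isIrreducible_evalRep E) hne },
    hmin, Submodule.subtype _, Subtype.val_injective, Submodule.range_subtype _,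
    fun a v => rfl⟩

/-- The type of a functor is invariant under isomorphism. -/
theorem HasType.of_iso {P' : FinCorr.{u} ⥤ ModuleCat.{u} k} (i : P ≅ P') {t : PosetTriple k}
    (ht : HasType P t) : HasType P' t := by
  let j : ∀ X, P.obj X ≃ₗ[k] P'.obj X := fun X => (i.app X).toLinearEquiv
  have hj : ∀ {X Y : FinCorr.{u}} (α : X ⟶ Y) (m : P.obj X),
      (P'.map α).hom (j X m) = j Y ((P.map α).hom m) := by
    intro X Y α m
    exact congrArg (fun f => f.hom m) (i.hom.naturality α).symm
  obtain ⟨θ, hθ, hr, he⟩ := ht.exists_map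
  refine ⟨fun Y hY => ?_, (j t.E).toLinearMap.comp θ, (j t.E).injective.comp hθ, ?_, ?_⟩
  · have := ht.vanishesBelow Y hY
    exact (j Y).symm.toEquiv.subsingleton
  · rw [LinearMap.range_comp, hr]
    ext m
    obtain ⟨m, rfl⟩ := (j t.E).surjective m
    have h1 : ∀ S, evalRep P' t.E (rel S) (j t.E m) = j t.E (evalRep P t.E (rel S) m) :=
      fun S => hj _ m
    have h2 : j t.E m ∈ (orderComponent (evalRep P t.E) t.R).map (j t.E).toLinearMap ↔
        m ∈ orderComponent (evalRep P t.E) t.R :=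
      (j t.E).injective.mem_set_image
    rw [h2, mem_orderComponent, mem_orderComponent]
    simp only [h1, EmbeddingLike.apply_eq_iff_eq, EmbeddingLike.map_eq_zero_iff]
  · intro a v
    change (P'.map _).hom (j t.E (θ v)) = j t.E (θ (t.ρ a v))
    rw [hj, ← he]
    rfl

end Transport

/-! ### The functors `S_{E,W}` -/

section SFunctor

variable {k : Type u} [Field k] {E : FinCorr.{u}} {W : Type u} [AddCommGroup W] [Module k W]
  {τ : Representation k (End E) W}

/-- The element `φ ⊗ w` of `L_{E,W}(X)`. -/
def lTmul (τ : Representation k (End E) W) {X : FinCorr.{u}} (φ : E ⟶ X) (w : W) : LObj E τ X :=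
  BalancedTensor.tmul (corrRight k E X) τ (Finsupp.single φ 1) w

lemma LMap_lTmul {X Y : FinCorr.{u}} (α : X ⟶ Y) (φ : E ⟶ X) (w : W) :
    LMap E τ α (lTmul τ φ w) = lTmul τ (φ ≫ α) w := by
  simp [LMap, lTmul]

lemma LEval_lTmul {X : FinCorr.{u}} (ψ : X ⟶ E) (φ : E ⟶ X) (w : W) :
    LEval E τ ψ (lTmul τ φ w) = τ (φ ≫ ψ : E ⟶ E) w := by
  simp [LEval, lTmul]

lemma lTmul_comp {X : FinCorr.{u}} (Q : End E) (φ : E ⟶ X) (w : W) :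
    lTmul τ ((Q : E ⟶ E) ≫ φ) w = lTmul τ φ (τ Q w) := by
  have h : corrRight k E X (MulOpposite.op Q) (Finsupp.single φ 1) =
      Finsupp.single ((Q : E ⟶ E) ≫ φ) 1 := by simp [corrRight]
  have := BalancedTensor.tmul_smul_right (corrRight k E X) τ (Finsupp.single φ 1) Q w
  rwa [h] at this

lemma lTmul_span {X : FinCorr.{u}} (N : Submodule k (LObj E τ X))
    (h : ∀ φ w, lTmul τ φ w ∈ N) : N = ⊤ := by
  refine eq_top_iff.mpr fun z _ => ?_
  induction z using BalancedTensor.induction with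
  | add x y hx hy => exact add_mem (hx trivial) (hy trivial)
  | tmul a w =>
    suffices h' : ∀ a, BalancedTensor.mk (corrRight k E X) τ a w ∈ N from h' a
    intro a
    induction a using Finsupp.induction_linear with
    | zero => rw [map_zero]; exact zero_mem _
    | add f g hf hg => rw [map_add]; exact add_mem hf hg
    | single φ c =>
      rw [← mul_one c, ← smul_eq_mul, ← Finsupp.smul_single, map_smul]
      exact N.smul_mem c (h φ w)

/-- The canonical map `W → S_{E,W}(E)`, `w ↦ id ⊗ w`. -/
def sUnit (τ : Representation k (End E) W) : W →ₗ[k] (SFunctorAux E τ).obj E :=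
  (JObj E τ E).mkQ.comp (BalancedTensor.mk (corrRight k E E) τ (Finsupp.single (𝟙 E) 1))

lemma sUnit_apply (w : W) : sUnit τ w = (JObj E τ E).mkQ (lTmul τ (𝟙 E) w) := rfl

lemma mem_JObj {X : FinCorr.{u}} {z : LObj E τ X} :
    z ∈ JObj E τ X ↔ ∀ ψ : X ⟶ E, LEval E τ ψ z = 0 := by
  simp [JObj]

lemma SFunctorAux_map_mkQ {X Y : FinCorr.{u}} (α : X ⟶ Y) (z : LObj E τ X) :
    ((SFunctorAux E τ).map α).hom ((JObj E τ X).mkQ z) = (JObj E τ Y).mkQ (LMap E τ α z) := rfl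

lemma sUnit_injective : Function.Injective (sUnit τ) := by
  refine (injective_iff_map_eq_zero _).mpr fun w hw => ?_
  rw [sUnit_apply] at hw
  have := mem_JObj.mp ((Submodule.Quotient.mk_eq_zero _).mp hw) (𝟙 E)
  rw [LEval_lTmul, Category.comp_id] at this
  have h1 : τ (𝟙 E : E ⟶ E) = 1 := map_one τ
  rwa [h1, Module.End.one_apply] at this

/-- On generators, `ψφ ⊗ w = id ⊗ (ψφ)w`. Thus the maps defining `J` are the maps induced by `ψ : X
⟶ E` under the identification of `S(E)` with `W`. -/
lemma map_mkQ_eq_sUnit {X : FinCorr.{u}} (ψ : X ⟶ E) (z : LObj E τ X) :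
    ((SFunctorAux E τ).map ψ).hom ((JObj E τ X).mkQ z) = sUnit τ (LEval E τ ψ z) := by
  have h : LinearMap.eqLocus (((SFunctorAux E τ).map ψ).hom.comp (JObj E τ X).mkQ)
      ((sUnit τ).comp (LEval E τ ψ)) = ⊤ := by
    refine lTmul_span _ fun φ w => ?_
    change ((SFunctorAux E τ).map ψ).hom ((JObj E τ X).mkQ _) = sUnit τ (LEval E τ ψ _)
    rw [SFunctorAux_map_mkQ, LMap_lTmul, LEval_lTmul, sUnit_apply]
    congr 1
    rw [← lTmul_comp, Category.comp_id]
  exact (h ▸ Submodule.mem_top : z ∈ LinearMap.eqLocus _ _)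

lemma sUnit_surjective : Function.Surjective (sUnit τ) := by
  intro x
  obtain ⟨z, rfl⟩ := Submodule.mkQ_surjective _ x
  refine ⟨LEval E τ (𝟙 E) z, ?_⟩
  rw [← map_mkQ_eq_sUnit, (SFunctorAux E τ).map_id]
  rfl

lemma evalRep_sUnit (Q : End E) (w : W) :
    evalRep (SFunctorAux E τ) E Q (sUnit τ w) = sUnit τ (τ Q w) := by
  rw [evalRep_apply, sUnit_apply, map_mkQ_eq_sUnit, LEval_lTmul, Category.id_comp]

/-- The functor `S_{E,W}` is simple if `W` is simple. -/
theorem isSimpleFunctor_SFunctorAux (hτ : τ.IsIrreducible) :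
    IsSimpleFunctor (SFunctorAux E τ) := by
  rw [Representation.isIrreducible_iff_submodule] at hτ
  obtain ⟨hW, hτ⟩ := hτ
  refine ⟨⟨E, sUnit_injective.nontrivial⟩, fun N hN => ?_⟩
  rcases hτ ((N E).comap (sUnit τ)) (fun Q w hw => by
    rw [Submodule.mem_comap, ← evalRep_sUnit]
    exact hN _ _ hw) with h | h
  · left
    intro X
    refine (Submodule.eq_bot_iff _).mpr fun x hx => ?_
    obtain ⟨z, rfl⟩ := Submodule.mkQ_surjective _ x
    -- Every `ψ : X ⟶ E` sends the class of `z` into `N(E) = 0`, which is exactly membership of `z`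
    -- in `J`.
    refine (Submodule.Quotient.mk_eq_zero _).mpr (mem_JObj.mpr fun ψ => ?_)
    have h1 : LEval E τ ψ z ∈ (N E).comap (sUnit τ) := by
      rw [Submodule.mem_comap, ← map_mkQ_eq_sUnit]
      exact hN ψ _ hx
    rwa [h] at h1
  · right
    intro X
    have h1 : (N X).comap (JObj E τ X).mkQ = ⊤ := by
      refine lTmul_span _ fun φ w => ?_
      have h2 : w ∈ (N E).comap (sUnit τ) := h ▸ Submodule.mem_top
      -- The generator `φ ⊗ w` is the image under `φ` of `id ⊗ w`, which lies in `N(E)`.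
      have h3 := hN φ _ h2
      rw [sUnit_apply, SFunctorAux_map_mkQ, LMap_lTmul, Category.id_comp] at h3
      exact h3
    refine eq_top_iff.mpr fun x _ => ?_
    obtain ⟨z, rfl⟩ := Submodule.mkQ_surjective _ x
    exact (h1 ▸ Submodule.mem_top : z ∈ (N X).comap (JObj E τ X).mkQ)

/-- For `Y` smaller than `E` every `ψφ` factors through `Y`, hence kills `W`, and `J(Y)` is
everything. -/
lemma vanishesBelow_SFunctorAux (hτ : ∀ Q, IsInessential Q → τ Q = 0) :
    VanishesBelow (SFunctorAux E τ) E := by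
  intro Y hY
  have h : JObj E τ Y = ⊤ := by
    refine lTmul_span _ fun φ w => mem_JObj.mpr fun ψ => ?_
    rw [LEval_lTmul, hτ _ ⟨Y, φ, ψ, hY, rfl⟩, LinearMap.zero_apply]
  exact Submodule.Quotient.subsingleton_iff.mpr h

lemma map_sUnit_orderComponent (R : OrderRel E) :
    (orderComponent τ R).map (sUnit τ) = orderComponent (evalRep (SFunctorAux E τ) E) R := by
  ext m
  obtain ⟨w, rfl⟩ := sUnit_surjective m
  have h2 : sUnit τ w ∈ (orderComponent τ R).map (sUnit τ) ↔ w ∈ orderComponent τ R :=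
    sUnit_injective.mem_set_image
  rw [h2, mem_orderComponent, mem_orderComponent]
  simp only [evalRep_sUnit, sUnit_injective.eq_iff, map_eq_zero_iff _ sUnit_injective]

end SFunctor

/-! ### The simplicity and the type of `S_{E,R,V}`. -/

section Main

variable {k : Type u} [Field k] (t : PosetTriple k)

lemma IsInduced.hasType {T : Type u} [AddCommGroup T] [Module k T]
    {τ : Representation k (End t.E) T} {s : PermutedOrders k t.E →ₗ[k] t.V →ₗ[k] T}
    (hs : IsInduced t.ρ τ s) : HasType (SFunctorAux t.E τ) t := by
  refine ⟨vanishesBelow_SFunctorAux hs.factorsThroughOrders.inessential, (sUnit τ).comp (s 1),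
    fun v w h => hs.injective (sUnit_injective h), ?_, fun a v => ?_⟩
  · rw [LinearMap.range_comp, hs.range_eq, map_sUnit_orderComponent]
  · rw [LinearMap.comp_apply, LinearMap.comp_apply, evalRep_sUnit, hs.perm_apply]

theorem PosetTriple.isSimpleFunctor : IsSimpleFunctor (SFunctorAux t.E (TRep t.R t.ρ)) :=
  isSimpleFunctor_SFunctorAux ((isInduced_tMk t.R t.ρ).isIrreducible t.simple)

theorem PosetTriple.hasType : HasType (SFunctorAux t.E (TRep t.R t.ρ)) t :=
  (isInduced_tMk t.R t.ρ).hasType t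

end Main

/-! ## Correspondence functors and their restrictions -/

section Restrict

variable {k : Type u} [Field k]

/-- The restriction of a correspondence functor to the category of correspondences. -/
def CorrFunctor.restrict (F : CorrFunctor k) : FinCorr.{u} ⥤ ModuleCat.{u} k :=
  Free.embedding k FinCorr.{u} ⋙ F.obj

/-- Morphisms of the linearization are linear combinations of correspondences and `F` is linear, so
stability under correspondences suffices. -/
lemma CorrFunctor.map_mem_of_restrict (F : CorrFunctor k)
    (N : ∀ X : FinCorr.{u}, Submodule k (F.restrict.obj X))
    (hN : ∀ {X Y : FinCorr.{u}} (α : X ⟶ Y) (m : F.restrict.obj X),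
      m ∈ N X → (F.restrict.map α).hom m ∈ N Y) {X Y : Free k FinCorr.{u}} (α : X ⟶ Y)
    (m : F.obj.obj X) (hm : m ∈ N X) : (F.obj.map α).hom m ∈ N Y := by
  have := F.property.1
  have := F.property.2
  induction α using Finsupp.induction_linear with
  | zero =>
    have h : F.obj.map (0 : X ⟶ Y) = 0 := F.obj.map_zero X Y
    exact (congrArg (fun f => f.hom m ∈ N Y) h).mpr (zero_mem _)
  | add f g hf hg =>
    have h : F.obj.map (f + g : X ⟶ Y) = F.obj.map f + F.obj.map g := F.obj.map_add
    exact (congrArg (fun f => f.hom m ∈ N Y) h).mpr (add_mem hf hg)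
  | single φ c =>
    have h1 : (Finsupp.single φ c : X ⟶ Y) = c • (Free.embedding k FinCorr.{u}).map φ := by
      change Finsupp.single φ c = c • Finsupp.single φ (1 : k)
      rw [Finsupp.smul_single, smul_eq_mul, mul_one]
    have h : F.obj.map (Finsupp.single φ c : X ⟶ Y) =
        c • F.obj.map ((Free.embedding k FinCorr.{u}).map φ) := by
      rw [h1]
      exact F.obj.map_smul _ _
    exact (congrArg (fun f => f.hom m ∈ N Y) h).mpr ((N Y).smul_mem c (hN φ m hm))

lemma CorrFunctor.isSimple_iff (F : CorrFunctor k) : F.IsSimple ↔ IsSimpleFunctor F.restrict := by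
  refine and_congr Iff.rfl ⟨fun h N hN => ?_, fun h N => ?_⟩
  · exact h ⟨N, fun α m hm => F.map_mem_of_restrict N hN α m hm⟩
  · exact h N.carrier fun α m hm => N.map_mem _ m hm

/-- A natural isomorphism between the restrictions extends to the linear functors, since naturality
on correspondences gives it on their linear combinations. -/
lemma CorrFunctor.nonempty_iso_iff (F G : CorrFunctor k) :
    Nonempty (F ≅ G) ↔ Nonempty (F.restrict ≅ G.restrict) := by
  have := F.property.1
  have := F.property.2
  have := G.property.1
  have := G.property.2
  constructor
  · rintro ⟨i⟩
    exact ⟨Functor.isoWhiskerLeft _ ((isLinearFunctor k).ι.mapIso i)⟩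
  · rintro ⟨i⟩
    exact ⟨(isLinearFunctor k).isoMk (Free.ext k i)⟩

lemma PosetTriple.nonempty_restrict_iso (t : PosetTriple k) :
    Nonempty (t.toFunctor.restrict ≅ SFunctorAux t.E (TRep t.R t.ρ)) :=
  ⟨Free.embeddingLiftIso k _⟩

lemma IsSimpleFunctor.of_iso {P P' : FinCorr.{u} ⥤ ModuleCat.{u} k} (i : P ≅ P')
    (hP : IsSimpleFunctor P) : IsSimpleFunctor P' := by
  let j : ∀ X, P.obj X ≃ₗ[k] P'.obj X := fun X => (i.app X).toLinearEquiv
  obtain ⟨⟨X, hX⟩, h⟩ := hP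
  refine ⟨⟨X, (j X).injective.nontrivial⟩, fun N hN => ?_⟩
  rcases h (fun X => (N X).comap (j X).toLinearMap) (fun {X Y} α m hm => by
    have h1 : (P'.map α).hom (j X m) = j Y ((P.map α).hom m) :=
      congrArg (fun f => f.hom m) (i.hom.naturality α).symm
    rw [Submodule.mem_comap, LinearEquiv.coe_coe, ← h1]
    exact hN α _ hm) with h | h
  · left
    intro X
    refine (Submodule.eq_bot_iff _).mpr fun m hm => ?_
    obtain ⟨m, rfl⟩ := (j X).surjective m
    have h1 : m ∈ (N X).comap (j X).toLinearMap := hm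
    rw [h, Submodule.mem_bot] at h1
    rw [h1, map_zero]
  · right
    intro X
    refine eq_top_iff.mpr fun m _ => ?_
    obtain ⟨m, rfl⟩ := (j X).surjective m
    exact (h X ▸ Submodule.mem_top : m ∈ (N X).comap (j X).toLinearMap)

end Restrict

end

/-- Over a field `k`, the assignment `(E,R,V) ↦ S_{E,R,V}` induces a bijection from the set of
isomorphism classes of triples `(E,R,V)` to the set of isomorphism classes of simple
correspondence functors. -/
theorem mainTheorem4 (k : Type u) [Field k] :
    ∃ (hS : ∀ t : PosetTriple k, t.toFunctor.IsSimple)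
      (Φ : Quotient (PosetTriple.setoid k) ≃ Quotient (simpleCorrFunctorSetoid k)),
      ∀ t : PosetTriple k,
        Φ (Quotient.mk (PosetTriple.setoid k) t) =
          Quotient.mk (simpleCorrFunctorSetoid k) ⟨t.toFunctor, hS t⟩ := by
  have hS : ∀ t : PosetTriple k, t.toFunctor.IsSimple := fun t => by
    obtain ⟨i⟩ := t.nonempty_restrict_iso
    exact (CorrFunctor.isSimple_iff _).mpr (t.isSimpleFunctor.of_iso i.symm)
  have hT : ∀ t : PosetTriple k, HasType t.toFunctor.restrict t := fun t => by
    obtain ⟨i⟩ := t.nonempty_restrict_iso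
    exact t.hasType.of_iso i.symm
  have hS' : ∀ t : PosetTriple k, IsSimpleFunctor t.toFunctor.restrict := fun t =>
    (CorrFunctor.isSimple_iff _).mp (hS t)
  -- Well defined: isomorphic triples give simple functors with a common type.
  let Ψ : Quotient (PosetTriple.setoid k) → Quotient (simpleCorrFunctorSetoid k) :=
    Quotient.map (fun t => ⟨t.toFunctor, hS t⟩) fun t t' h =>
      (CorrFunctor.nonempty_iso_iff _ _).mpr
        (((hT t).of_isIso h).nonempty_iso (hS' t) (hS' t') (hT t'))
  have hΨ : Function.Bijective Ψ := by
    constructor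
    · rintro ⟨t⟩ ⟨t'⟩ h
      have h1 : Nonempty (t.toFunctor ≅ t'.toFunctor) := Quotient.exact h
      obtain ⟨i⟩ := (CorrFunctor.nonempty_iso_iff _ _).mp h1
      -- Through `i`, the functor of `t'` has both types `t` and `t'`, and its type is unique.
      exact Quotient.sound (((hT t).of_iso i).isIso (hS' t') (hT t'))
    · rintro ⟨⟨F, hF⟩⟩
      have hF' := (CorrFunctor.isSimple_iff F).mp hF
      -- `F` has some type `t`, which it shares with `S_{E,R,V}` for that `t`; simple functors of
      -- equal type are isomorphic.
      obtain ⟨t, ht⟩ := hF'.exists_hasType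
      refine ⟨Quotient.mk _ t, Quotient.sound ?_⟩
      exact (CorrFunctor.nonempty_iso_iff _ _).mpr ((hT t).nonempty_iso (hS' t) hF' ht)
  exact ⟨hS, Equiv.ofBijective Ψ hΨ, fun t => rfl⟩
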